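/- Let $V$ be a finite-dimensional irreducible rational (algebraic) representation of $\mathrm{GL}_4(\mathbb{C})$ with highest weight $\lambda=(\lambda_1\ge\lambda_2\ge\lambda_3\ge\lambda_4)\in\mathbb{Z}^4$ with respect to the diagonal torus and the upper triangular Borel subgroup. Then $V$ has trivial central character if and only if $\lambda_1+\lambda_2+\lambda_3+\lambda_4=0$. Assume this is the case, and let $d(\lambda_1,\lambda_2,\lambda_3,\lambda_4)$ be the dimension of the zero weight space of $V$, i.e. of the space of vectors fixed by the diagonal torus. Define $$p_1=\tfrac12(\lambda_2-\lambda_3+1)(\lambda_3-\lambda_4+1)(\lambda_2-\lambda_4+2),$$ $$p_2=\tfrac12(\lambda_1-\lambda_2+1)(\lambda_2-\lambda_3+1)(\lambda_1-\lambda_3+2),$$ $$p_3=-\tfrac12(\lambda_1+\lambda_2+2\lambda_3+1)(-\lambda_1\lambda_2+2\lambda_2^2+\lambda_1\lambda_3+\lambda_2\lambda_3+\lambda_3^2-\lambda_1+\lambda_3-2),$$ $$p_4=\tfrac12(-\lambda_1+\lambda_2-1)(-\lambda_1\lambda_2+\lambda_1\lambda_3+\lambda_2\lambda_3+3\lambda_3^2-\lambda_1-2\lambda_2-\lambda_3-2).$$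 Then $d$ is given as follows: 1. $d=p_1$ if $\lambda_2\le 0$; 2. $d=p_2$ if $\lambda_3\ge 0$; 3. $d=p_3$ if $\lambda_2>0$, $\lambda_3<0$ and $\lambda_1+\lambda_4\ge 0$; 4. $d=p_4$ if $\lambda_2>0$, $\lambda_3<0$ and $\lambda_1+\lambda_4\le 0$. These four regions cover the whole domain $\{\lambda\in\mathbb{R}^4:\lambda_1\ge\lambda_2\ge\lambda_3\ge\lambda_4,\ \sum_i\lambda_i=0\}$. The involution $(\lambda_1,\lambda_2,\lambda_3,\lambda_4)\mapsto(-\lambda_4,-\lambda_3,-\lambda_2,-\lambda_1)$ corresponds to taking a representation to its dual: if $V$ is as above, then $V^*$ is again an irreducible rational representation with trivial central character, of highest weight $(-\lambda_4,-\lambda_3,-\lambda_2,-\lambda_1)$. On the domain it interchanges regions (1) and (2), and regions (3) and (4); and, as functions on the hyperplane $\lambda_1+\lambda_2+\lambda_3+\lambda_4=0$, it interchanges $p_1$ with $p_2$ and $p_3$ with $p_4$. Further, $$p_3-p_4=(\lambda_2+\lambda_3)-(\lambda_2+\lambda_3)^3.$$ -/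

import Mathlib

open Matrix

noncomputable section

namespace ZeroWeight

/-- A complex-valued function on `GL_n(ℂ)` is regular if it is a polynomial in the matrix entries
and in `det⁻¹`. -/
def IsRegularFun {n : ℕ} (f : GL (Fin n) ℂ → ℂ) : Prop :=
  ∃ (N : ℕ) (P : MvPolynomial (Fin n × Fin n) ℂ), ∀ g : GL (Fin n) ℂ,
    f g = ((g : Matrix (Fin n) (Fin n) ℂ).det)⁻¹ ^ N *
      MvPolynomial.eval (fun ij => (g : Matrix (Fin n) (Fin n) ℂ) ij.1 ij.2) P

/-- A rational (algebraic) representation of `GL_n(ℂ)`: all its matrix coefficients are regular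
functions. -/
def IsRational {n : ℕ} {V : Type*} [AddCommGroup V] [Module ℂ V]
    (ρ : Representation ℂ (GL (Fin n) ℂ) V) : Prop :=
  ∀ (v : V) (φ : Module.Dual ℂ V), IsRegularFun fun g => φ (ρ g v)

/-- The product `∏ᵢ gᵢᵢ ^ μᵢ`: on diagonal matrices this is the character with weight `μ` of the
diagonal torus, on upper triangular ones its extension to the Borel subgroup. -/
def weightChar {n : ℕ} (μ : Fin n → ℤ) (g : GL (Fin n) ℂ) : ℂ :=
  ∏ i, (g : Matrix (Fin n) (Fin n) ℂ) i i ^ μ i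

/-- The `μ`-weight space with respect to the torus of invertible diagonal matrices. -/
def weightSpace {n : ℕ} {V : Type*} [AddCommGroup V] [Module ℂ V]
    (ρ : Representation ℂ (GL (Fin n) ℂ) V) (μ : Fin n → ℤ) : Submodule ℂ V where
  carrier := {v | ∀ g : GL (Fin n) ℂ, (g : Matrix (Fin n) (Fin n) ℂ).IsDiag →
    ρ g v = weightChar μ g • v}
  add_mem' := by
    intro a b ha hb g hg
    rw [map_add, ha g hg, hb g hg, smul_add]
  zero_mem' := by
    intro g _
    rw [map_zero, smul_zero]
  smul_mem' := by
    intro c v hv g hg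
    rw [map_smul, hv g hg, smul_comm]

/-- `ρ` has highest weight `μ`: some nonzero vector is an eigenvector with character `μ` of the
Borel subgroup of invertible upper triangular matrices. (For irreducible `ρ` this determines
`μ`.) -/
def HasHighestWeight {n : ℕ} {V : Type*} [AddCommGroup V] [Module ℂ V]
    (ρ : Representation ℂ (GL (Fin n) ℂ) V) (μ : Fin n → ℤ) : Prop :=
  ∃ v : V, v ≠ 0 ∧ ∀ g : GL (Fin n) ℂ, (g : Matrix (Fin n) (Fin n) ℂ).BlockTriangular id →
    ρ g v = weightChar μ g • v

/-- The centre of `GL_n(ℂ)` acts trivially. -/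
def HasTrivialCentralChar {n : ℕ} {V : Type*} [AddCommGroup V] [Module ℂ V]
    (ρ : Representation ℂ (GL (Fin n) ℂ) V) : Prop :=
  ∀ z ∈ Subgroup.center (GL (Fin n) ℂ), ρ z = 1

/-- The map `(x₁, x₂, x₃, x₄) ↦ (-x₄, -x₃, -x₂, -x₁)`. -/
def dualWeight {R : Type*} [Neg R] (x : Fin 4 → R) : Fin 4 → R :=
  ![-x 3, -x 2, -x 1, -x 0]

/-- The cone `x₁ ≥ x₂ ≥ x₃ ≥ x₄`, `x₁ + x₂ + x₃ + x₄ = 0`. The coordinates `x₁, …, x₄` are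
`x 0, …, x 3`. -/
def domain : Set (Fin 4 → ℝ) :=
  {x | x 0 ≥ x 1 ∧ x 1 ≥ x 2 ∧ x 2 ≥ x 3 ∧ x 0 + x 1 + x 2 + x 3 = 0}

def region₁ : Set (Fin 4 → ℝ) := {x ∈ domain | x 1 ≤ 0}

def region₂ : Set (Fin 4 → ℝ) := {x ∈ domain | x 2 ≥ 0}

def region₃ : Set (Fin 4 → ℝ) := {x ∈ domain | x 1 > 0 ∧ x 2 < 0 ∧ x 0 + x 3 ≥ 0}

def region₄ : Set (Fin 4 → ℝ) := {x ∈ domain | x 1 > 0 ∧ x 2 < 0 ∧ x 0 + x 3 ≤ 0}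

def p₁ (x : Fin 4 → ℝ) : ℝ :=
  1 / 2 * (x 1 - x 2 + 1) * (x 2 - x 3 + 1) * (x 1 - x 3 + 2)

def p₂ (x : Fin 4 → ℝ) : ℝ :=
  1 / 2 * (x 0 - x 1 + 1) * (x 1 - x 2 + 1) * (x 0 - x 2 + 2)

def p₃ (x : Fin 4 → ℝ) : ℝ :=
  -(1 / 2) * (x 0 + x 1 + 2 * x 2 + 1) *
    (-(x 0 * x 1) + 2 * x 1 ^ 2 + x 0 * x 2 + x 1 * x 2 + x 2 ^ 2 - x 0 + x 2 - 2)

def p₄ (x : Fin 4 → ℝ) : ℝ :=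
  1 / 2 * (-x 0 + x 1 - 1) *
    (-(x 0 * x 1) + x 0 * x 2 + x 1 * x 2 + 3 * x 2 ^ 2 - x 0 - 2 * x 1 - x 2 - 2)

end ZeroWeight

end

/-! Multiplying `ρ` by a power `N` of the determinant clears denominators and gives a matrix-valued
polynomial `R = polyMap P`, multiplicative on invertible matrices. Its differential at the identity
is `lieMap P`, and its restriction to the torus splits into projections `weightMat P s`. The zero
weight space of `ρ` is the weight space of `(N, N, N, N)` for `R`, so `d` is the trace of a
projection, that is, a coefficient of the character `χ = torusTrace P 1`.

The character is computed by Casimir and Laplacian, without integration or Verma modules. The words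
in lowering operators applied to the highest weight vector span the irreducible module; hence all
weights are dominated by the highest weight `m`, which has multiplicity one, and the central Casimir
operator is a scalar. Taking traces of the Casimir operator against `R(t)`, and commuting root
vectors past `R(t)` to evaluate the root terms, gives a second-order differential equation for `χ`.
After multiplication by the Vandermonde product `Δ` it says that `Δχ` is an eigenvector of the sum
of the squared Euler operators, with eigenvalue `|m + δ|²`, `δ = (3, 2, 1, 0)`. Thus the exponents
of `Δχ` lie on a sphere. As `Δχ` is antisymmetric, only its strictly decreasing exponents matter;
dominance leaves just `m + δ`, and `Δχ` is the alternant of `m + δ`.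

Column operations on alternants give the branching rule, hence an expansion of `χ` over
Gelfand–Tsetlin patterns, and `d` counts the patterns of weight zero. Their third row is `(a, b, -a
- b)`, and it can be completed downwards in `a - b + 1` or `a + 2b + 1` ways according to the sign
of `b`. For each `b` the admissible `a` form an interval whose ends are affine in `b` between
breakpoints, so the count is piecewise cubic. The upper bound for `a` changes at `b = λ₂ + λ₃ = -(λ₁
+ λ₄)`, which is why the sign of `λ₁ + λ₄` separates regions 3 and 4.

For the dual, the projection to the highest weight line is an eigenvector of the lower triangular
group acting on the right; conjugating by the longest permutation turns it into a highest weight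
vector of the dual. -/

noncomputable section

/-! ### Polynomial representations of `GL_n` and their differentials -/

namespace ZeroWeight

/-- A matrix of polynomials in the entries of an `n × n` matrix, as a matrix-valued function. -/
def polyMap {n d : ℕ} (P : Matrix (Fin d) (Fin d) (MvPolynomial (Fin n × Fin n) ℂ))
    (A : Matrix (Fin n) (Fin n) ℂ) : Matrix (Fin d) (Fin d) ℂ :=
  P.map (MvPolynomial.eval fun ij => A ij.1 ij.2)

/-- The matrix-valued polynomial function `polyMap P` is a representation of `GL_n(ℂ)`. -/
structure IsPolyRep {n d : ℕ} (P : Matrix (Fin d) (Fin d) (MvPolynomial (Fin n × Fin n) ℂ)) :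
    Prop where
  map_one : polyMap P 1 = 1
  map_mul : ∀ A B : Matrix (Fin n) (Fin n) ℂ, A.det ≠ 0 → B.det ≠ 0 →
    polyMap P (A * B) = polyMap P A * polyMap P B

section MatrixDeriv

variable {k m o : Type*}

/-- Entrywise derivative of a matrix-valued function of one complex variable. -/
def HasMatrixDerivAt (F : ℂ → Matrix k m ℂ) (F' : Matrix k m ℂ) (s : ℂ) : Prop :=
  ∀ a b, HasDerivAt (fun z => F z a b) (F' a b) s

lemma HasMatrixDerivAt.mul [Fintype m] {F : ℂ → Matrix k m ℂ} {G : ℂ → Matrix m o ℂ} {F' : Matrix k m ℂ}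
    {G' : Matrix m o ℂ} {s : ℂ} (hF : HasMatrixDerivAt F F' s) (hG : HasMatrixDerivAt G G' s) :
    HasMatrixDerivAt (fun z => F z * G z) (F' * G s + F s * G') s := by
  intro a b
  simp only [Matrix.mul_apply, Matrix.add_apply, ← Finset.sum_add_distrib]
  exact HasDerivAt.fun_sum fun c _ => (hF a c).mul (hG c b)

lemma HasMatrixDerivAt.const (A : Matrix k m ℂ) (s : ℂ) : HasMatrixDerivAt (fun _ => A) 0 s :=
  fun a b => by simpa using hasDerivAt_const s (A a b)

lemma HasMatrixDerivAt.unique {F : ℂ → Matrix k m ℂ} {F' F'' : Matrix k m ℂ} {s : ℂ}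
    (h : HasMatrixDerivAt F F' s) (h' : HasMatrixDerivAt F F'' s) : F' = F'' := by
  ext a b
  exact (h a b).unique (h' a b)

lemma HasMatrixDerivAt.congr {F G : ℂ → Matrix k m ℂ} {F' : Matrix k m ℂ} {s : ℂ}
    (h : HasMatrixDerivAt F F' s) (hG : ∀ᶠ z in nhds s, G z = F z) : HasMatrixDerivAt G F' s := by
  intro a b
  refine (h a b).congr_of_eventuallyEq ?_
  filter_upwards [hG] with z hz
  rw [hz]

lemma hasMatrixDerivAt_line (A B : Matrix k m ℂ) (s : ℂ) :
    HasMatrixDerivAt (fun z => A + z • B) B s := by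
  intro a b
  simpa using ((hasDerivAt_id s).mul_const (B a b)).const_add (A a b)

end MatrixDeriv

lemma hasDerivAt_eval {σ : Type*} [Fintype σ] [DecidableEq σ] (p : MvPolynomial σ ℂ) {c : ℂ → σ → ℂ}
    {c' : σ → ℂ} {s : ℂ} (hc : ∀ i, HasDerivAt (fun z => c z i) (c' i) s) :
    HasDerivAt (fun z => MvPolynomial.eval (c z) p)
      (∑ i, c' i * MvPolynomial.eval (c s) (MvPolynomial.pderiv i p)) s := by
  induction p using MvPolynomial.induction_on with
  | C a => simpa using hasDerivAt_const s a
  | add p q hp hq =>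
    simp only [map_add, mul_add, Finset.sum_add_distrib]
    exact hp.add hq
  | mul_X p j hp =>
    have h := hp.mul (hc j)
    simp only [map_mul, MvPolynomial.eval_X, Derivation.leibniz, MvPolynomial.pderiv_X, smul_eq_mul,
      map_add, mul_add, Finset.sum_add_distrib]
    refine h.congr_deriv ?_
    rw [add_comm, Finset.sum_mul]
    congr 1
    · rw [Finset.sum_eq_single j]
      · simp [mul_comm]
      · intro b _ hb
        simp [Ne.symm hb]
      · simp
    · exact Finset.sum_congr rfl fun i _ => by ring

variable {n d : ℕ} {P : Matrix (Fin d) (Fin d) (MvPolynomial (Fin n × Fin n) ℂ)}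

/-- The directional derivative of `polyMap P` at `g`. -/
def polyMapDeriv (P : Matrix (Fin d) (Fin d) (MvPolynomial (Fin n × Fin n) ℂ))
    (g : Matrix (Fin n) (Fin n) ℂ) :
    Matrix (Fin n) (Fin n) ℂ →ₗ[ℂ] Matrix (Fin d) (Fin d) ℂ where
  toFun X := Matrix.of fun a b => ∑ ij : Fin n × Fin n, X ij.1 ij.2 *
    MvPolynomial.eval (fun ij => g ij.1 ij.2) (MvPolynomial.pderiv ij (P a b))
  map_add' X Y := by
    ext a b
    simp [add_mul, Finset.sum_add_distrib]
  map_smul' c X := by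
    ext a b
    simp [Finset.mul_sum, mul_assoc]

/-- The differential of `polyMap P` at the identity matrix. -/
def lieMap (P : Matrix (Fin d) (Fin d) (MvPolynomial (Fin n × Fin n) ℂ)) :
    Matrix (Fin n) (Fin n) ℂ →ₗ[ℂ] Matrix (Fin d) (Fin d) ℂ :=
  polyMapDeriv P 1

lemma hasMatrixDerivAt_polyMap (P : Matrix (Fin d) (Fin d) (MvPolynomial (Fin n × Fin n) ℂ))
    {F : ℂ → Matrix (Fin n) (Fin n) ℂ} {F' : Matrix (Fin n) (Fin n) ℂ} {s : ℂ}
    (hF : HasMatrixDerivAt F F' s) :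
    HasMatrixDerivAt (fun z => polyMap P (F z)) (polyMapDeriv P (F s) F') s := by
  intro a b
  exact hasDerivAt_eval (P a b) (c := fun z ij => F z ij.1 ij.2) (c' := fun ij => F' ij.1 ij.2)
    fun ij => hF ij.1 ij.2

lemma hasMatrixDerivAt_linear (f : Matrix (Fin n) (Fin n) ℂ →ₗ[ℂ] Matrix (Fin d) (Fin d) ℂ)
    (A B : Matrix (Fin n) (Fin n) ℂ) (s : ℂ) :
    HasMatrixDerivAt (fun z => f (A + z • B)) (f B) s := by
  simpa using hasMatrixDerivAt_line (f A) (f B) s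

lemma eventually_det_ne_zero (X : Matrix (Fin n) (Fin n) ℂ) :
    ∀ᶠ z : ℂ in nhds 0, (1 + z • X).det ≠ 0 := by
  have h : Continuous fun z : ℂ => (1 + z • X).det := by fun_prop
  exact h.continuousAt.eventually_ne (by simp)

namespace IsPolyRep

/-- Differentiate `R(g(1 + zX)) = R(g)R(1 + zX)` at `z = 0`. Multiplicativity is available only for
invertible arguments, which is enough because `1 + zX` is invertible for small `z`. -/
lemma polyMapDeriv_mul_left (h : IsPolyRep P) {g : Matrix (Fin n) (Fin n) ℂ} (hg : g.det ≠ 0)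
    (X : Matrix (Fin n) (Fin n) ℂ) :
    polyMapDeriv P g (g * X) = polyMap P g * lieMap P X := by
  have h1 := hasMatrixDerivAt_polyMap P (hasMatrixDerivAt_line g (g * X) 0)
  have h2 := (HasMatrixDerivAt.const (polyMap P g) 0).mul
    (hasMatrixDerivAt_polyMap P (hasMatrixDerivAt_line 1 X 0))
  have h3 := h1.unique (h2.congr (by
    filter_upwards [eventually_det_ne_zero X] with z hz
    rw [← h.map_mul _ _ hg hz, mul_add, mul_one, Matrix.mul_smul]))
  simpa [lieMap] using h3

lemma polyMapDeriv_mul_right (h : IsPolyRep P) {g : Matrix (Fin n) (Fin n) ℂ} (hg : g.det ≠ 0)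
    (X : Matrix (Fin n) (Fin n) ℂ) :
    polyMapDeriv P g (X * g) = lieMap P X * polyMap P g := by
  have h1 := hasMatrixDerivAt_polyMap P (hasMatrixDerivAt_line g (X * g) 0)
  have h2 := (hasMatrixDerivAt_polyMap P (hasMatrixDerivAt_line 1 X 0)).mul
    (HasMatrixDerivAt.const (polyMap P g) 0)
  have h3 := h1.unique (h2.congr (by
    filter_upwards [eventually_det_ne_zero X] with z hz
    rw [← h.map_mul _ _ hz hg, add_mul, one_mul, Matrix.smul_mul]))
  simpa [lieMap] using h3

/-- Both sides are the derivative of `R` at `g` in the direction `g * X * g`. This is the adjoint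
equivariance of the differential, written without inverses. -/
lemma polyMap_mul_lieMap (h : IsPolyRep P) {g : Matrix (Fin n) (Fin n) ℂ} (hg : g.det ≠ 0)
    (X : Matrix (Fin n) (Fin n) ℂ) :
    polyMap P g * lieMap P (X * g) = lieMap P (g * X) * polyMap P g := by
  rw [← h.polyMapDeriv_mul_left hg, ← h.polyMapDeriv_mul_right hg, Matrix.mul_assoc]

/-- Apply the equivariance to `g = 1 + zX` and differentiate at `z = 0`. The form is that of a rule
for moving `X` to the right past `Y`. -/
lemma lieMap_bracket (h : IsPolyRep P) (X Y : Matrix (Fin n) (Fin n) ℂ) :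
    lieMap P X * lieMap P Y = lieMap P Y * lieMap P X + lieMap P (X * Y - Y * X) := by
  have hR := hasMatrixDerivAt_polyMap P (hasMatrixDerivAt_line 1 X 0)
  have h1 := hR.mul (hasMatrixDerivAt_linear (lieMap P) Y (Y * X) 0)
  have h2 := (hasMatrixDerivAt_linear (lieMap P) Y (X * Y) 0).mul hR
  have h3 := h1.unique (h2.congr (by
    filter_upwards [eventually_det_ne_zero X] with z hz
    have := h.polyMap_mul_lieMap hz Y
    rwa [mul_add, add_mul, one_mul, mul_one, Matrix.smul_mul, Matrix.mul_smul] at this))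
  simp only [zero_smul, add_zero, h.map_one, mul_one, one_mul] at h3
  rw [map_sub]
  change lieMap P X * lieMap P Y + _ = _ + lieMap P Y * lieMap P X at h3
  rw [← add_sub_assoc, eq_sub_iff_add_eq, h3, add_comm]

end IsPolyRep

end ZeroWeight
end

/-! ### Weight projections of the diagonal torus -/

noncomputable section

namespace ZeroWeight

variable {n d : ℕ} {P : Matrix (Fin d) (Fin d) (MvPolynomial (Fin n × Fin n) ℂ)}

/-- Coefficients of matrix-valued polynomials are determined by the values at points with nonzero
coordinates. -/
lemma eq_of_sum_monomial_smul_eq {k m : Type*} (S : Finset (Fin n →₀ ℕ))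
    {A B : (Fin n →₀ ℕ) → Matrix k m ℂ}
    (h : ∀ t : Fin n → ℂ, (∀ i, t i ≠ 0) →
      ∑ s ∈ S, (∏ i, t i ^ s i) • A s = ∑ s ∈ S, (∏ i, t i ^ s i) • B s)
    {s : Fin n →₀ ℕ} (hs : s ∈ S) : A s = B s := by
  ext a b
  have key : (∑ s ∈ S, MvPolynomial.monomial s (A s a b)) =
      ∑ s ∈ S, MvPolynomial.monomial s (B s a b) := by
    refine MvPolynomial.funext_set (fun _ => {z : ℂ | z ≠ 0})
      (fun _ => (Set.finite_singleton (0 : ℂ)).infinite_compl) fun t ht => ?_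
    have := congrArg (fun M => M a b) (h t fun i => ht i trivial)
    simpa [MvPolynomial.eval_monomial, Matrix.sum_apply, Finsupp.prod_fintype, mul_comm] using this
  have := congrArg (MvPolynomial.coeff s) key
  simpa [MvPolynomial.coeff_sum, MvPolynomial.coeff_monomial, hs] using this

/-- The entries of `polyMap P` on diagonal matrices, as polynomials in the diagonal entries. -/
def torusPoly (P : Matrix (Fin d) (Fin d) (MvPolynomial (Fin n × Fin n) ℂ)) (a b : Fin d) :
    MvPolynomial (Fin n) ℂ :=
  MvPolynomial.aeval (fun ij => if ij.1 = ij.2 then MvPolynomial.X ij.1 else 0) (P a b)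

/-- The projection to the weight space of weight `s`. -/
def weightMat (P : Matrix (Fin d) (Fin d) (MvPolynomial (Fin n × Fin n) ℂ)) (s : Fin n →₀ ℕ) :
    Matrix (Fin d) (Fin d) ℂ :=
  Matrix.of fun a b => MvPolynomial.coeff s (torusPoly P a b)

/-- A finite set containing all weights. -/
def weightSupp (P : Matrix (Fin d) (Fin d) (MvPolynomial (Fin n × Fin n) ℂ)) :
    Finset (Fin n →₀ ℕ) :=
  Finset.univ.biUnion fun a => Finset.univ.biUnion fun b => (torusPoly P a b).support

lemma weightMat_eq_zero {s : Fin n →₀ ℕ} (hs : s ∉ weightSupp P) : weightMat P s = 0 := by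
  ext a b
  simp only [weightSupp, Finset.mem_biUnion, Finset.mem_univ, true_and, not_exists] at hs
  simpa [weightMat] using hs a b

lemma eval_torusPoly (t : Fin n → ℂ) (a b : Fin d) :
    MvPolynomial.eval t (torusPoly P a b) = polyMap P (diagonal t) a b := by
  rw [torusPoly, MvPolynomial.aeval_def, MvPolynomial.algebraMap_eq, MvPolynomial.eval_eval₂,
    polyMap, Matrix.map_apply, MvPolynomial.eval, MvPolynomial.coe_eval₂Hom]
  congr 1
  · ext z
    simp
  · funext ij
    by_cases h : ij.1 = ij.2
    · simp [h]
    · simp [h]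

lemma polyMap_diagonal (P : Matrix (Fin d) (Fin d) (MvPolynomial (Fin n × Fin n) ℂ))
    (t : Fin n → ℂ) :
    polyMap P (diagonal t) = ∑ s ∈ weightSupp P, (∏ i, t i ^ s i) • weightMat P s := by
  ext a b
  rw [← eval_torusPoly, MvPolynomial.eval_eq', Matrix.sum_apply]
  refine (Finset.sum_subset (fun s hs => ?_) fun s _ hs => ?_).trans
    (Finset.sum_congr rfl fun s _ => ?_)
  · simp only [weightSupp, Finset.mem_biUnion, Finset.mem_univ, true_and]
    exact ⟨a, b, hs⟩
  · rw [MvPolynomial.notMem_support_iff.mp hs, zero_mul]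
  · simp [weightMat, mul_comm]

lemma det_diagonal_ne_zero {t : Fin n → ℂ} (ht : ∀ i, t i ≠ 0) : (diagonal t).det ≠ 0 := by
  rw [det_diagonal]
  exact Finset.prod_ne_zero_iff.mpr fun i _ => ht i

/-- `w` is a vector of weight `μ`. -/
def IsWeightVec (P : Matrix (Fin d) (Fin d) (MvPolynomial (Fin n × Fin n) ℂ)) (μ : Fin n → ℤ)
    (w : Fin d → ℂ) : Prop :=
  ∀ t : Fin n → ℂ, (∀ i, t i ≠ 0) → polyMap P (diagonal t) *ᵥ w = (∏ i, t i ^ μ i) • w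

namespace IsPolyRep

lemma polyMap_diagonal_mul (h : IsPolyRep P) {t u : Fin n → ℂ} (ht : ∀ i, t i ≠ 0)
    (hu : ∀ i, u i ≠ 0) :
    polyMap P (diagonal t) * polyMap P (diagonal u) = polyMap P (diagonal fun i => t i * u i) := by
  rw [← h.map_mul _ _ (det_diagonal_ne_zero ht) (det_diagonal_ne_zero hu), diagonal_mul_diagonal]

/-- Compare the coefficients of the monomials in `u` in `R(t)R(u) = R(tu)`. -/
lemma polyMap_diagonal_mul_weightMat (h : IsPolyRep P) {t : Fin n → ℂ} (ht : ∀ i, t i ≠ 0)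
    (s : Fin n →₀ ℕ) :
    polyMap P (diagonal t) * weightMat P s = (∏ i, t i ^ s i) • weightMat P s := by
  by_cases hs : s ∈ weightSupp P
  · refine eq_of_sum_monomial_smul_eq (weightSupp P) (A := fun s => polyMap P (diagonal t) * _)
      (B := fun s => (∏ i, t i ^ s i) • weightMat P s) (fun u hu => ?_) hs
    have := h.polyMap_diagonal_mul ht hu
    rw [polyMap_diagonal P u, polyMap_diagonal P fun i => t i * u i, Matrix.mul_sum] at this
    simpa only [mul_comm (t _) (u _), mul_pow, Finset.prod_mul_distrib, ← smul_smul,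
      Matrix.mul_smul] using this
  · simp [weightMat_eq_zero hs]

lemma weightMat_mul_polyMap_diagonal (h : IsPolyRep P) {t : Fin n → ℂ} (ht : ∀ i, t i ≠ 0)
    (s : Fin n →₀ ℕ) :
    weightMat P s * polyMap P (diagonal t) = (∏ i, t i ^ s i) • weightMat P s := by
  by_cases hs : s ∈ weightSupp P
  · refine eq_of_sum_monomial_smul_eq (weightSupp P) (A := fun s => _ * polyMap P (diagonal t))
      (B := fun s => (∏ i, t i ^ s i) • weightMat P s) (fun u hu => ?_) hs
    have := h.polyMap_diagonal_mul hu ht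
    rw [polyMap_diagonal P u, polyMap_diagonal P fun i => u i * t i, Matrix.sum_mul] at this
    simpa only [mul_pow, Finset.prod_mul_distrib, ← smul_smul, Matrix.smul_mul] using this
  · simp [weightMat_eq_zero hs]

lemma sum_weightMat (h : IsPolyRep P) : ∑ s ∈ weightSupp P, weightMat P s = 1 := by
  have := polyMap_diagonal P fun _ => 1
  simpa [h.map_one, diagonal_one] using this.symm

lemma isWeightVec_weightMat (h : IsPolyRep P) (s : Fin n →₀ ℕ) (w : Fin d → ℂ) :
    IsWeightVec P (fun i => s i) (weightMat P s *ᵥ w) := by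
  intro t ht
  rw [mulVec_mulVec, h.polyMap_diagonal_mul_weightMat ht, smul_mulVec]
  simp

lemma weightMat_mulVec_of_ne (h : IsPolyRep P) {μ : Fin n → ℤ} {w : Fin d → ℂ}
    (hw : IsWeightVec P μ w) {s : Fin n →₀ ℕ} (hs : (fun i => (s i : ℤ)) ≠ μ) :
    weightMat P s *ᵥ w = 0 := by
  obtain ⟨i, hi⟩ := Function.ne_iff.mp hs
  -- The torus element with entry 2 at a place `i` where the weights differ, and 1 elsewhere,
  -- separates them, since integer powers of 2 are distinct.
  have ht : ∀ j, (Function.update (1 : Fin n → ℂ) i 2) j ≠ 0 := by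
    intro j
    by_cases hj : j = i
    · subst hj; simp
    · simp [hj]
  have h1 := congrArg (weightMat P s *ᵥ ·) (hw _ ht)
  simp only [mulVec_mulVec, h.weightMat_mul_polyMap_diagonal ht, mulVec_smul, smul_mulVec] at h1
  have e1 : ∏ j, (Function.update (1 : Fin n → ℂ) i 2) j ^ s j = (2 : ℂ) ^ ((s i : ℕ) : ℤ) := by
    rw [Finset.prod_eq_single i] <;> simp +contextual [Function.update_of_ne]
  have e2 : ∏ j, (Function.update (1 : Fin n → ℂ) i 2) j ^ μ j = (2 : ℂ) ^ μ i := by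
    rw [Finset.prod_eq_single i] <;> simp +contextual [Function.update_of_ne]
  rw [e1, e2, ← sub_eq_zero, ← sub_smul] at h1
  refine (smul_eq_zero.mp h1).resolve_left fun h2 => hi ?_
  have h3 := congrArg (‖·‖) (sub_eq_zero.mp h2)
  simp only [norm_zpow, Complex.norm_ofNat] at h3
  exact zpow_right_injective₀ (by norm_num) (by norm_num) h3

lemma weightMat_mulVec_of_eq (h : IsPolyRep P) {s : Fin n →₀ ℕ} {w : Fin d → ℂ}
    (hw : IsWeightVec P (fun i => s i) w) : weightMat P s *ᵥ w = w := by
  have h1 : (∑ r ∈ weightSupp P, weightMat P r) *ᵥ w = w := by rw [h.sum_weightMat, one_mulVec]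
  rw [Matrix.sum_mulVec] at h1
  conv_rhs => rw [← h1]
  have h2 : ∀ r ≠ s, weightMat P r *ᵥ w = 0 := fun r hr => h.weightMat_mulVec_of_ne hw
    fun e => hr (Finsupp.ext fun i => by exact_mod_cast congrFun e i)
  symm
  refine Finset.sum_eq_single s (fun r _ hr => h2 r hr) fun hs => ?_
  rw [weightMat_eq_zero hs, zero_mulVec]

/-- `L(E_{ii})` acts on the weight space of weight `s` by `s i`. -/
lemma lieMap_single_mul_weightMat (h : IsPolyRep P) (i : Fin n) (s : Fin n →₀ ℕ) :
    lieMap P (Matrix.single i i 1) * weightMat P s = (s i : ℂ) • weightMat P s := by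
  have h1 := (hasMatrixDerivAt_polyMap P (hasMatrixDerivAt_line 1 (Matrix.single i i 1) 0)).mul
    (HasMatrixDerivAt.const (weightMat P s) 0)
  have h2 : HasMatrixDerivAt (fun z : ℂ => (1 + z) ^ s i • weightMat P s)
      ((s i : ℂ) • weightMat P s) 0 := by
    intro a b
    have := (((hasDerivAt_id (0 : ℂ)).const_add 1).pow (s i)).mul_const (weightMat P s a b)
    simpa using this
  have h3 := h1.unique (h2.congr (by
    have h4 : ∀ᶠ z : ℂ in nhds 0, 1 + z ≠ 0 :=
      (show Continuous fun z : ℂ => 1 + z by fun_prop).continuousAt.eventually_ne (by simp)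
    filter_upwards [h4] with z hz
    have h5 : (1 + z • Matrix.single i i 1 : Matrix (Fin n) (Fin n) ℂ) =
        diagonal (Function.update 1 i (1 + z)) := by
      ext a b
      by_cases hab : a = b
      · subst hab
        by_cases ha : a = i
        · subst ha; simp
        · simp [ha, Matrix.single_apply_of_ne _ _ _ _ _ (fun hh => ha hh.1.symm)]
      · rw [Matrix.diagonal_apply_ne _ hab]
        simp only [Matrix.add_apply, Matrix.one_apply_ne hab, Matrix.smul_apply, zero_add]
        rw [Matrix.single_apply_of_ne _ _ _ _ _ (fun hh => hab (hh.1.symm.trans hh.2)), smul_zero]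
    rw [h5, h.polyMap_diagonal_mul_weightMat]
    · congr 1
      rw [Finset.prod_eq_single i] <;> simp +contextual [Function.update_of_ne]
    · intro j
      by_cases hj : j = i
      · subst hj; simpa
      · simp [hj]))
  simpa [lieMap] using h3

/-- The matrix unit `E_ij` is an eigenvector of conjugation by `diagonal t` with eigenvalue `t i / t
j`; the denominator is cleared. -/
lemma polyMap_diagonal_mul_lieMap_single (h : IsPolyRep P) {t : Fin n → ℂ} (ht : ∀ i, t i ≠ 0)
    (i j : Fin n) :
    t j • (polyMap P (diagonal t) * lieMap P (Matrix.single i j 1)) =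
      t i • (lieMap P (Matrix.single i j 1) * polyMap P (diagonal t)) := by
  have := h.polyMap_mul_lieMap (det_diagonal_ne_zero ht) (Matrix.single i j 1)
  have e1 : (Matrix.single i j 1 : Matrix (Fin n) (Fin n) ℂ) * diagonal t =
      t j • Matrix.single i j 1 := by
    ext a b
    rw [Matrix.mul_diagonal, Matrix.smul_apply, Matrix.single_apply]
    split_ifs with hh
    · simp [hh.2]
    · simp
  have e2 : diagonal t * (Matrix.single i j 1 : Matrix (Fin n) (Fin n) ℂ) =
      t i • Matrix.single i j 1 := by
    ext a b
    rw [Matrix.diagonal_mul, Matrix.smul_apply, Matrix.single_apply]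
    split_ifs with hh
    · simp [hh.1]
    · simp
  rw [e1, e2] at this
  simpa only [map_smul, Matrix.mul_smul, Matrix.smul_mul] using this

lemma isWeightVec_lieMap (h : IsPolyRep P) {μ : Fin n → ℤ} {w : Fin d → ℂ}
    (hw : IsWeightVec P μ w) (i j : Fin n) :
    IsWeightVec P (μ + Pi.single i 1 - Pi.single j 1) (lieMap P (Matrix.single i j 1) *ᵥ w) := by
  intro t ht
  have h1 := congrArg (· *ᵥ w) (h.polyMap_diagonal_mul_lieMap_single ht i j)
  simp only [smul_mulVec, ← mulVec_mulVec, hw t ht, mulVec_smul] at h1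
  have h2 : (∏ k, t k ^ (μ + Pi.single i 1 - Pi.single j 1 : Fin n → ℤ) k) =
      (∏ k, t k ^ μ k) * t i * (t j)⁻¹ := by
    have e : ∀ k, t k ^ (μ + Pi.single i 1 - Pi.single j 1 : Fin n → ℤ) k =
        t k ^ μ k * t k ^ (Pi.single i 1 : Fin n → ℤ) k *
          (t k ^ (Pi.single j 1 : Fin n → ℤ) k)⁻¹ := fun k => by
      rw [Pi.sub_apply, Pi.add_apply, zpow_sub₀ (ht k), zpow_add₀ (ht k), div_eq_mul_inv]
    simp only [e, Finset.prod_mul_distrib, Finset.prod_inv_distrib]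
    congr 2
    · rw [Finset.prod_eq_single i] <;> simp +contextual
    · rw [Finset.prod_eq_single j] <;> simp +contextual
  rw [h2, mul_comm, ← smul_smul, mul_comm, ← smul_smul, ← h1, smul_smul, inv_mul_cancel₀ (ht j), one_smul]

end IsPolyRep

end ZeroWeight
end

/-! ### Highest weight vectors, lowering words and the Casimir operator -/

noncomputable section

namespace ZeroWeight

variable {n d : ℕ} {P : Matrix (Fin d) (Fin d) (MvPolynomial (Fin n × Fin n) ℂ)}

/-- `v` is a highest weight vector of weight `μ`. -/
structure IsHighestVec (P : Matrix (Fin d) (Fin d) (MvPolynomial (Fin n × Fin n) ℂ))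
    (μ : Fin n → ℤ) (v : Fin d → ℂ) : Prop where
  ne_zero : v ≠ 0
  upper : ∀ g : Matrix (Fin n) (Fin n) ℂ, g.det ≠ 0 → g.BlockTriangular id →
    polyMap P g *ᵥ v = (∏ i, g i i ^ μ i) • v

/-- The representation `polyMap P` has no proper nonzero invariant subspace. -/
def IsIrreduciblePoly (P : Matrix (Fin d) (Fin d) (MvPolynomial (Fin n × Fin n) ℂ)) : Prop :=
  ∀ W : Submodule ℂ (Fin d → ℂ), (∀ g : Matrix (Fin n) (Fin n) ℂ, g.det ≠ 0 → ∀ w ∈ W,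
    polyMap P g *ᵥ w ∈ W) → W = ⊥ ∨ W = ⊤

/-- The vectors obtained from `v` by applying lowering operators, with their weights. -/
inductive LowerWord (P : Matrix (Fin d) (Fin d) (MvPolynomial (Fin n × Fin n) ℂ))
    (l : Fin n → ℤ) (v : Fin d → ℂ) : (Fin n → ℤ) → (Fin d → ℂ) → Prop
  | base : LowerWord P l v l v
  | step {μ : Fin n → ℤ} {w : Fin d → ℂ} (i j : Fin n) (hij : j < i) (hw : LowerWord P l v μ w) :
      LowerWord P l v (μ + Pi.single i 1 - Pi.single j 1) (lieMap P (Matrix.single i j 1) *ᵥ w)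

/-- The span of all lower words. -/
def wordSpan (P : Matrix (Fin d) (Fin d) (MvPolynomial (Fin n × Fin n) ℂ))
    (l : Fin n → ℤ) (v : Fin d → ℂ) : Submodule ℂ (Fin d → ℂ) :=
  Submodule.span ℂ {w | ∃ μ, LowerWord P l v μ w}

/-- The Casimir operator. -/
def casimir (P : Matrix (Fin d) (Fin d) (MvPolynomial (Fin n × Fin n) ℂ)) :
    Matrix (Fin d) (Fin d) ℂ :=
  ∑ i, ∑ j, lieMap P (Matrix.single i j 1) * lieMap P (Matrix.single j i 1)

lemma lieMap_mul_single (X : Matrix (Fin n) (Fin n) ℂ) (i j : Fin n) :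
    lieMap P (X * Matrix.single i j 1) = ∑ k, X k i • lieMap P (Matrix.single k j 1) := by
  have : X * Matrix.single i j 1 = ∑ k, X k i • Matrix.single k j (1 : ℂ) := by
    ext a b
    by_cases hb : b = j
    · subst hb; simp [Matrix.sum_apply, Matrix.single_apply]
    · simp [Matrix.sum_apply, hb, Ne.symm hb]
  rw [this, map_sum]
  simp only [map_smul]

lemma lieMap_single_mul (X : Matrix (Fin n) (Fin n) ℂ) (i j : Fin n) :
    lieMap P (Matrix.single i j 1 * X) = ∑ k, X j k • lieMap P (Matrix.single i k 1) := by
  have : Matrix.single i j 1 * X = ∑ k, X j k • Matrix.single i k (1 : ℂ) := by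
    ext a b
    by_cases ha : a = i
    · subst ha; simp [Matrix.sum_apply, Matrix.single_apply]
    · simp [Matrix.sum_apply, ha, Ne.symm ha]
  rw [this, map_sum]
  simp only [map_smul]

lemma lieMap_eq_sum (X : Matrix (Fin n) (Fin n) ℂ) :
    lieMap P X = ∑ i, ∑ j, X i j • lieMap P (Matrix.single i j 1) := by
  conv_lhs => rw [Matrix.matrix_eq_sum_single X]
  simp only [map_sum, ← map_smul, Matrix.smul_single, smul_eq_mul, mul_one]

namespace IsPolyRep

/-- The bases `E_ij` and `E_ji` are dual for the trace form, so the commutators with `X` cancel in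
the sum. -/
lemma lieMap_mul_casimir (h : IsPolyRep P) (X : Matrix (Fin n) (Fin n) ℂ) :
    lieMap P X * casimir P = casimir P * lieMap P X := by
  -- The four terms of `[X, E_ij] E_ji + E_ij [X, E_ji]` are paired so that, after expansion in
  -- matrix units, each pair sums to zero by exchanging two summation indices.
  have e : ∀ i j, lieMap P X * (lieMap P (Matrix.single i j 1) * lieMap P (Matrix.single j i 1)) =
      lieMap P (Matrix.single i j 1) * lieMap P (Matrix.single j i 1) * lieMap P X +
      ((lieMap P (X * Matrix.single i j 1) * lieMap P (Matrix.single j i 1) -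
        lieMap P (Matrix.single i j 1) * lieMap P (Matrix.single j i 1 * X)) +
      (lieMap P (Matrix.single i j 1) * lieMap P (X * Matrix.single j i 1) -
        lieMap P (Matrix.single i j 1 * X) * lieMap P (Matrix.single j i 1))) := by
    intro i j
    rw [← mul_assoc, h.lieMap_bracket X (Matrix.single i j 1), add_mul, mul_assoc,
      h.lieMap_bracket X (Matrix.single j i 1), mul_add, map_sub, map_sub]
    noncomm_ring
  have z1 : ∑ i, ∑ j, (lieMap P (X * Matrix.single i j 1) * lieMap P (Matrix.single j i 1) -
      lieMap P (Matrix.single i j 1) * lieMap P (Matrix.single j i 1 * X)) = 0 := by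
    simp only [lieMap_mul_single, lieMap_single_mul, Finset.sum_sub_distrib, Finset.sum_mul,
      Finset.mul_sum, Matrix.smul_mul, Matrix.mul_smul]
    rw [sub_eq_zero, Finset.sum_comm]
    conv_rhs => rw [Finset.sum_comm]
    refine Finset.sum_congr rfl fun j _ => ?_
    rw [Finset.sum_comm]
  have z2 : ∑ i, ∑ j, (lieMap P (Matrix.single i j 1) * lieMap P (X * Matrix.single j i 1) -
      lieMap P (Matrix.single i j 1 * X) * lieMap P (Matrix.single j i 1)) = 0 := by
    simp only [lieMap_mul_single, lieMap_single_mul, Finset.sum_sub_distrib, Finset.sum_mul,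
      Finset.mul_sum, Matrix.smul_mul, Matrix.mul_smul]
    rw [sub_eq_zero]
    refine Finset.sum_congr rfl fun j _ => ?_
    rw [Finset.sum_comm]
  simp only [casimir, Finset.mul_sum, Finset.sum_mul, e, Finset.sum_add_distrib, z1, z2, add_zero]

/-- Only weights with entries in `ℕ` occur in a polynomial representation; for any other `μ` the
vector `w` is zero, being killed by every projection. -/
lemma lieMap_single_self_mulVec (h : IsPolyRep P) {μ : Fin n → ℤ} {w : Fin d → ℂ}
    (hw : IsWeightVec P μ w) (i : Fin n) :
    lieMap P (Matrix.single i i 1) *ᵥ w = (μ i : ℂ) • w := by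
  by_cases hs : ∃ s : Fin n →₀ ℕ, (fun i => (s i : ℤ)) = μ
  · obtain ⟨s, rfl⟩ := hs
    conv_lhs => rw [← h.weightMat_mulVec_of_eq hw]
    rw [mulVec_mulVec, h.lieMap_single_mul_weightMat, smul_mulVec, h.weightMat_mulVec_of_eq hw]
    simp
  · have : w = 0 := by
      have h1 : (∑ r ∈ weightSupp P, weightMat P r) *ᵥ w = w := by rw [h.sum_weightMat, one_mulVec]
      rw [← h1, Matrix.sum_mulVec]
      exact Finset.sum_eq_zero fun s _ => h.weightMat_mulVec_of_ne hw fun e => hs ⟨s, e⟩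
    simp [this]

/-- Since `E_ij` has square zero, `(1 + s E_ij) E_ij = E_ij`, so the direction `E_ij` at the point
`1 + s E_ij` is a left translate of `E_ij` at the identity. -/
lemma hasMatrixDerivAt_transvection (h : IsPolyRep P) {i j : Fin n} (hij : i ≠ j) (s : ℂ) :
    HasMatrixDerivAt (fun z => polyMap P (1 + z • Matrix.single i j 1))
      (polyMap P (1 + s • Matrix.single i j 1) * lieMap P (Matrix.single i j 1)) s := by
  have h1 := hasMatrixDerivAt_polyMap P (hasMatrixDerivAt_line 1 (Matrix.single i j 1) s)
  have hdet : (1 + s • Matrix.single i j 1 : Matrix (Fin n) (Fin n) ℂ).det ≠ 0 := by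
    have := Matrix.det_transvection_of_ne i j hij s
    rw [Matrix.transvection] at this
    rw [Matrix.smul_single, smul_eq_mul, mul_one, this]
    exact one_ne_zero
  have h2 := h.polyMapDeriv_mul_left hdet (Matrix.single i j 1)
  rw [add_mul, one_mul, Matrix.smul_mul, Matrix.single_mul_single_of_ne _ _ _ _ hij.symm,
    smul_zero, add_zero] at h2
  rwa [h2] at h1

/-- A subspace stable under the torus and the root vectors is stable under `GL_n(ℂ)`. -/
lemma polyMap_mem (h : IsPolyRep P) {W : Submodule ℂ (Fin d → ℂ)}
    (hT : ∀ t : Fin n → ℂ, (∀ i, t i ≠ 0) → ∀ w ∈ W, polyMap P (diagonal t) *ᵥ w ∈ W)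
    (hL : ∀ i j : Fin n, i ≠ j → ∀ w ∈ W, lieMap P (Matrix.single i j 1) *ᵥ w ∈ W)
    {g : Matrix (Fin n) (Fin n) ℂ} (hg : g.det ≠ 0) : ∀ w ∈ W, polyMap P g *ᵥ w ∈ W := by
  refine Matrix.diagonal_transvection_induction_of_det_ne_zero
    (fun g => ∀ w ∈ W, polyMap P g *ᵥ w ∈ W) g hg (fun t ht => hT t fun i => ?_)
    (fun t => ?_) (fun A B hA hB h1 h2 w hw => ?_)
  · rw [det_diagonal] at ht
    exact Finset.prod_ne_zero_iff.mp ht i (Finset.mem_univ i)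
  · obtain ⟨i, j, hij, c⟩ := t
    intro w hw
    -- A functional `φ` vanishing on `W` gives a polynomial `z ↦ φ(R(1 + z E_ij) w)`. Its derivative
    -- is the same function with `w` replaced by the vector `lieMap P E_ij *ᵥ w` of `W`, so by
    -- induction every coefficient reduces to a value of `φ` on `W` at `z = 0`. No exponential
    -- series is needed.
    rw [← Subspace.forall_mem_dualAnnihilator_apply_eq_zero_iff W]
    intro φ hφ
    rw [Submodule.mem_dualAnnihilator] at hφ
    have hφe : ∀ x : Fin d → ℂ, φ x = ∑ a, x a * φ (Pi.single a 1) := fun x => by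
      conv_lhs => rw [pi_eq_sum_univ' x]
      simp [map_sum]
    have hq : ∀ w : Fin d → ℂ, ∃ q : Polynomial ℂ, ∀ z : ℂ,
        q.eval z = φ (polyMap P (1 + z • Matrix.single i j 1) *ᵥ w) := by
      intro w
      refine ⟨∑ a, (∑ b, MvPolynomial.aeval (fun kl : Fin n × Fin n =>
        Polynomial.C ((1 : Matrix (Fin n) (Fin n) ℂ) kl.1 kl.2) + Polynomial.X *
          Polynomial.C ((Matrix.single i j 1 : Matrix (Fin n) (Fin n) ℂ) kl.1 kl.2)) (P a b) *
            Polynomial.C (w b)) * Polynomial.C (φ (Pi.single a 1)), fun z => ?_⟩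
      rw [hφe, Polynomial.eval_finsetSum]
      refine Finset.sum_congr rfl fun a _ => ?_
      rw [Polynomial.eval_mul, Polynomial.eval_C, Polynomial.eval_finsetSum]
      congr 1
      refine Finset.sum_congr rfl fun b _ => ?_
      rw [Polynomial.eval_mul, Polynomial.eval_C]
      congr 1
      change _ = MvPolynomial.eval (fun ij => (1 + z • Matrix.single i j 1 :
        Matrix (Fin n) (Fin n) ℂ) ij.1 ij.2) (P a b)
      rw [← Polynomial.coe_evalRingHom, MvPolynomial.aeval_def, MvPolynomial.eval₂_comp_left,
        MvPolynomial.eval, MvPolynomial.coe_eval₂Hom]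
      congr 1
      · ext z
        simp
      · funext kl
        by_cases hkl : i = kl.1 ∧ j = kl.2 <;> simp [Matrix.single_apply, hkl]
    have hcoeff : ∀ k, ∀ w ∈ W, ∀ q : Polynomial ℂ, (∀ z : ℂ,
        q.eval z = φ (polyMap P (1 + z • Matrix.single i j 1) *ᵥ w)) → q.coeff k = 0 := by
      intro k
      induction k with
      | zero =>
        intro w hw q hq
        rw [Polynomial.coeff_zero_eq_eval_zero, hq, zero_smul, add_zero, h.map_one, one_mulVec]
        exact hφ w hw
      | succ k ih =>
        intro w hw q hq
        have h1 := ih _ (hL i j hij w hw) (Polynomial.derivative q) fun z => by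
          refine (q.hasDerivAt z).unique ?_
          have h2 : HasDerivAt (fun z => ∑ a, (∑ b, polyMap P (1 + z • Matrix.single i j 1) a b *
              w b) * φ (Pi.single a 1)) (∑ a, (∑ b, (polyMap P (1 + z • Matrix.single i j 1) *
                lieMap P (Matrix.single i j 1)) a b * w b) * φ (Pi.single a 1)) z :=
            HasDerivAt.fun_sum fun a _ => (HasDerivAt.fun_sum fun b _ =>
              (h.hasMatrixDerivAt_transvection hij z a b).mul_const (w b)).mul_const _
          rw [mulVec_mulVec, hφe]
          refine h2.congr_of_eventuallyEq (Filter.Eventually.of_forall fun z => ?_)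
          change q.eval z = _
          rw [hq, hφe]
          rfl
        rw [Polynomial.coeff_derivative] at h1
        exact (mul_eq_zero.mp h1).resolve_right (by exact_mod_cast Nat.succ_ne_zero k)
    obtain ⟨q, hq⟩ := hq w
    have hq0 : q = 0 := Polynomial.ext fun k => hcoeff k w hw q hq
    have := hq c
    rw [hq0, Polynomial.eval_zero, Matrix.smul_single, smul_eq_mul, mul_one] at this
    exact this.symm
  · rw [h.map_mul A B hA hB, ← mulVec_mulVec]
    exact h1 _ (h2 w hw)

end IsPolyRep

namespace IsHighestVec

variable {l : Fin n → ℤ} {v : Fin d → ℂ}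

lemma isWeightVec (hv : IsHighestVec P l v) : IsWeightVec P l v := by
  intro t ht
  simpa using hv.upper _ (det_diagonal_ne_zero ht) (Matrix.blockTriangular_diagonal t)

/-- The matrices `1 + z E_ij` with `i < j` are unipotent upper triangular and fix `v`; differentiate
in `z`. The vector is treated as a one-column matrix so that the product rule for matrices applies.
-/
lemma lieMap_mulVec_eq_zero (h : IsPolyRep P) (hv : IsHighestVec P l v) {i j : Fin n}
    (hij : i < j) : lieMap P (Matrix.single i j 1) *ᵥ v = 0 := by
  have h1 := (h.hasMatrixDerivAt_transvection hij.ne 0).mul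
    (HasMatrixDerivAt.const (Matrix.replicateCol Unit v) 0)
  have h2 : (fun z : ℂ => polyMap P (1 + z • Matrix.single i j 1) * Matrix.replicateCol Unit v) =
      fun _ => Matrix.replicateCol Unit v := by
    funext z
    have h3 := hv.upper (Matrix.transvection i j z)
      (by rw [Matrix.det_transvection_of_ne i j hij.ne]; exact one_ne_zero) (by
        intro a b hab
        have hab' : b < a := hab
        rw [Matrix.transvection, Matrix.add_apply, Matrix.one_apply_ne hab'.ne',
          Matrix.single_apply_of_ne _ _ _ _ _ fun hh => ?_, zero_add]
        rw [hh.1, hh.2] at hij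
        exact absurd hij (not_lt.mpr hab'.le))
    have h4 : ∀ k, Matrix.transvection i j z k k = 1 := fun k => by
      rw [Matrix.transvection, Matrix.add_apply, Matrix.one_apply_eq,
        Matrix.single_apply_of_ne _ _ _ _ _ (fun hh => hij.ne (hh.1.trans hh.2.symm)), add_zero]
    simp only [h4, _root_.one_zpow, Finset.prod_const_one, one_smul] at h3
    rw [← Matrix.replicateCol_mulVec, Matrix.smul_single, smul_eq_mul, mul_one]
    exact congrArg _ h3
  rw [h2] at h1
  have h5 := h1.unique (HasMatrixDerivAt.const _ 0)
  simp only [zero_smul, add_zero, h.map_one, one_mul, Matrix.mul_zero] at h5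
  rw [← Matrix.replicateCol_mulVec] at h5
  funext a
  exact congrFun (congrFun h5 a) ()

end IsHighestVec

namespace LowerWord

variable {l μ : Fin n → ℤ} {v w : Fin d → ℂ}

lemma mem_wordSpan (hw : LowerWord P l v μ w) : w ∈ wordSpan P l v :=
  Submodule.subset_span ⟨μ, hw⟩

lemma isWeightVec (h : IsPolyRep P) (hv : IsHighestVec P l v) (hw : LowerWord P l v μ w) :
    IsWeightVec P μ w := by
  induction hw with
  | base => exact hv.isWeightVec
  | step i j hij _ ih => exact h.isWeightVec_lieMap ih i j

lemma lieMap_lower_mem {i j : Fin n} (hij : j < i) (hw : w ∈ wordSpan P l v) :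
    lieMap P (Matrix.single i j 1) *ᵥ w ∈ wordSpan P l v := by
  induction hw using Submodule.span_induction with
  | mem w hw =>
    obtain ⟨μ, hw⟩ := hw
    exact (hw.step i j hij).mem_wordSpan
  | zero => simp
  | add x y _ _ hx hy =>
    rw [mulVec_add]
    exact add_mem hx hy
  | smul c x _ hx =>
    rw [mulVec_smul]
    exact Submodule.smul_mem _ c hx

/-- Move `X` past the outermost lowering operator. The commutator is again a matrix applied to the
shorter word, so the induction has to run over all `X` at once. -/
lemma lieMap_mem (h : IsPolyRep P) (hv : IsHighestVec P l v) (hw : LowerWord P l v μ w)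
    (X : Matrix (Fin n) (Fin n) ℂ) : lieMap P X *ᵥ w ∈ wordSpan P l v := by
  induction hw generalizing X with
  | base =>
    rw [lieMap_eq_sum, Matrix.sum_mulVec]
    refine Submodule.sum_mem _ fun i _ => ?_
    rw [Matrix.sum_mulVec]
    refine Submodule.sum_mem _ fun j _ => ?_
    rw [smul_mulVec]
    refine Submodule.smul_mem _ _ ?_
    have hvm : v ∈ wordSpan P l v := LowerWord.base.mem_wordSpan
    rcases lt_trichotomy i j with hij | rfl | hij
    · rw [hv.lieMap_mulVec_eq_zero h hij]
      exact Submodule.zero_mem _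
    · rw [h.lieMap_single_self_mulVec hv.isWeightVec]
      exact Submodule.smul_mem _ _ hvm
    · exact lieMap_lower_mem hij hvm
  | step i j hij _ ih =>
    rw [mulVec_mulVec, h.lieMap_bracket, add_mulVec, ← mulVec_mulVec]
    exact add_mem (lieMap_lower_mem hij (ih X)) (ih _)

end LowerWord

/-- The span is stable under the torus, because words are weight vectors, and under all root
vectors, hence under `GL_n`; it contains `v`, so irreducibility applies. -/
lemma IsHighestVec.wordSpan_eq_top {l : Fin n → ℤ} {v : Fin d → ℂ} (h : IsPolyRep P)
    (hirr : IsIrreduciblePoly P) (hv : IsHighestVec P l v) : wordSpan P l v = ⊤ := by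
  refine (hirr (wordSpan P l v) fun g hg => h.polyMap_mem (fun t ht w hw => ?_)
    (fun i j _ w hw => ?_) hg).resolve_left fun hbot => ?_
  · induction hw using Submodule.span_induction with
    | mem w hw =>
      obtain ⟨μ, hw⟩ := hw
      rw [hw.isWeightVec h hv t ht]
      exact Submodule.smul_mem _ _ hw.mem_wordSpan
    | zero => simp
    | add x y _ _ hx hy =>
      rw [mulVec_add]
      exact add_mem hx hy
    | smul c x _ hx =>
      rw [mulVec_smul]
      exact Submodule.smul_mem _ c hx
  · induction hw using Submodule.span_induction with
    | mem w hw =>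
      obtain ⟨μ, hw⟩ := hw
      exact hw.lieMap_mem h hv _
    | zero => simp
    | add x y _ _ hx hy =>
      rw [mulVec_add]
      exact add_mem hx hy
    | smul c x _ hx =>
      rw [mulVec_smul]
      exact Submodule.smul_mem _ c hx
  · have : v ∈ wordSpan P l v := LowerWord.base.mem_wordSpan
    rw [hbot, Submodule.mem_bot] at this
    exact hv.ne_zero this

/-- Two matrices that agree on all lower words are equal. -/
lemma IsHighestVec.matrix_ext {l : Fin n → ℤ} {v : Fin d → ℂ} (h : IsPolyRep P)
    (hirr : IsIrreduciblePoly P) (hv : IsHighestVec P l v) {A B : Matrix (Fin d) (Fin d) ℂ}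
    (hAB : ∀ μ w, LowerWord P l v μ w → A *ᵥ w = B *ᵥ w) : A = B := by
  refine Matrix.toLin'.injective (LinearMap.ext_on (hv.wordSpan_eq_top h hirr) ?_)
  rintro w ⟨μ, hw⟩
  simpa using hAB μ w hw

/-- The Casimir operator commutes with the lowering operators, so its eigenvalue on `v` propagates
to every word. -/
lemma IsHighestVec.casimir_eq {l : Fin n → ℤ} {v : Fin d → ℂ} (h : IsPolyRep P)
    (hirr : IsIrreduciblePoly P) (hv : IsHighestVec P l v) {c : ℂ} (hc : casimir P *ᵥ v = c • v) :
    casimir P = c • (1 : Matrix (Fin d) (Fin d) ℂ) := by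
  refine hv.matrix_ext h hirr fun μ w hw => ?_
  rw [smul_mulVec, one_mulVec]
  induction hw with
  | base => exact hc
  | step i j hij _ ih =>
    rw [mulVec_mulVec, ← h.lieMap_mul_casimir, ← mulVec_mulVec, ih, mulVec_smul]

end ZeroWeight
end

/-! ### The character on the torus and Euler operators -/

noncomputable section

namespace ZeroWeight

section

variable {n d : ℕ} {P : Matrix (Fin d) (Fin d) (MvPolynomial (Fin n × Fin n) ℂ)}

/-- The function `t ↦ trace (R(diag t) M)` on the torus, as a polynomial. For `M = 1` this is the
character. -/
def torusTrace (P : Matrix (Fin d) (Fin d) (MvPolynomial (Fin n × Fin n) ℂ)) :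
    Matrix (Fin d) (Fin d) ℂ →ₗ[ℂ] MvPolynomial (Fin n) ℂ where
  toFun M := ∑ s ∈ weightSupp P, MvPolynomial.monomial s (weightMat P s * M).trace
  map_add' M N := by simp [mul_add, Finset.sum_add_distrib]
  map_smul' c M := by simp [Finset.smul_sum, MvPolynomial.smul_monomial]

lemma coeff_torusTrace (M : Matrix (Fin d) (Fin d) ℂ) (s : Fin n →₀ ℕ) :
    MvPolynomial.coeff s (torusTrace P M) = (weightMat P s * M).trace := by
  by_cases hs : s ∈ weightSupp P
  · simp [torusTrace, MvPolynomial.coeff_sum, MvPolynomial.coeff_monomial, hs]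
  · simp [torusTrace, MvPolynomial.coeff_sum, MvPolynomial.coeff_monomial, hs,
      weightMat_eq_zero hs]

lemma eval_torusTrace (M : Matrix (Fin d) (Fin d) ℂ) (t : Fin n → ℂ) :
    MvPolynomial.eval t (torusTrace P M) = (polyMap P (diagonal t) * M).trace := by
  rw [polyMap_diagonal, Finset.sum_mul, Matrix.trace_sum]
  simp [torusTrace, MvPolynomial.eval_monomial, Finsupp.prod_fintype, mul_comm]

lemma mvPolynomial_ext_of_ne_zero {p q : MvPolynomial (Fin n) ℂ}
    (h : ∀ t : Fin n → ℂ, (∀ i, t i ≠ 0) → MvPolynomial.eval t p = MvPolynomial.eval t q) :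
    p = q :=
  MvPolynomial.funext_set (fun _ => {z : ℂ | z ≠ 0})
    (fun _ => (Set.finite_singleton (0 : ℂ)).infinite_compl) fun t ht => h t fun i => ht i trivial

/-- The Euler derivation `X i * ∂ / ∂ X i`. -/
def euler (i : Fin n) : Derivation ℂ (MvPolynomial (Fin n) ℂ) (MvPolynomial (Fin n) ℂ) :=
  (MvPolynomial.X i : MvPolynomial (Fin n) ℂ) • MvPolynomial.pderiv i

lemma euler_X (i j : Fin n) : euler i (MvPolynomial.X j : MvPolynomial (Fin n) ℂ) =
    if i = j then MvPolynomial.X i else 0 := by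
  by_cases h : i = j
  · subst h; simp [euler]
  · simp [euler, MvPolynomial.pderiv_X_of_ne (Ne.symm h), h]

lemma coeff_euler (i : Fin n) (p : MvPolynomial (Fin n) ℂ) (s : Fin n →₀ ℕ) :
    MvPolynomial.coeff s (euler i p) = s i * MvPolynomial.coeff s p := by
  induction p using MvPolynomial.induction_on' with
  | monomial u a =>
    have : euler i (MvPolynomial.monomial u a) = MvPolynomial.monomial u (u i * a) := by
      change MvPolynomial.X i * MvPolynomial.pderiv i _ = _
      rw [MvPolynomial.X_mul_pderiv_monomial, MvPolynomial.smul_monomial, nsmul_eq_mul]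
    rw [this, MvPolynomial.coeff_monomial, MvPolynomial.coeff_monomial]
    split_ifs with h
    · rw [h]
    · simp
  | add p q hp hq => rw [map_add, MvPolynomial.coeff_add, hp, hq, MvPolynomial.coeff_add, mul_add]

namespace IsPolyRep

lemma trace_weightMat_mul_lieMap (h : IsPolyRep P) (M : Matrix (Fin d) (Fin d) ℂ) (i : Fin n)
    (s : Fin n →₀ ℕ) : (weightMat P s * (M * lieMap P (Matrix.single i i 1))).trace =
      s i * (weightMat P s * M).trace := by
  rw [← mul_assoc, Matrix.trace_mul_comm, ← mul_assoc, h.lieMap_single_mul_weightMat,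
    Matrix.smul_mul, Matrix.trace_smul, smul_eq_mul]

lemma torusTrace_mul_lieMap (h : IsPolyRep P) (M : Matrix (Fin d) (Fin d) ℂ) (i : Fin n) :
    torusTrace P (M * lieMap P (Matrix.single i i 1)) = euler i (torusTrace P M) := by
  ext s
  rw [coeff_euler, coeff_torusTrace, coeff_torusTrace, h.trace_weightMat_mul_lieMap]

lemma torusTrace_lieMap (h : IsPolyRep P) (i : Fin n) :
    torusTrace P (lieMap P (Matrix.single i i 1)) = euler i (torusTrace P 1) := by
  rw [← h.torusTrace_mul_lieMap, one_mul]

/-- Write `T` for the trace of `R(t) E_ji E_ij`. Cyclicity and `t_j R(t) E_ij = t_i E_ij R(t)` give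
`t_j tr(R(t) E_ij E_ji) = t_i T`, while `E_ij E_ji = E_ji E_ij + E_ii - E_jj`. This expresses the
root terms of the Casimir operator through the character alone. -/
lemma torusTrace_root (h : IsPolyRep P) {i j : Fin n} :
    (MvPolynomial.X i - MvPolynomial.X j) * torusTrace P
      (lieMap P (Matrix.single j i 1) * lieMap P (Matrix.single i j 1)) =
    MvPolynomial.X j * (euler i (torusTrace P 1) - euler j (torusTrace P 1)) := by
  refine mvPolynomial_ext_of_ne_zero fun t ht => ?_
  rw [← h.torusTrace_lieMap, ← h.torusTrace_lieMap]
  simp only [_root_.map_mul, map_sub, MvPolynomial.eval_X, eval_torusTrace]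
  have h1 := congrArg (fun M => (M * lieMap P (Matrix.single j i 1)).trace)
    (h.polyMap_diagonal_mul_lieMap_single ht i j)
  simp only [Matrix.smul_mul, Matrix.trace_smul, smul_eq_mul] at h1
  rw [mul_assoc, h.lieMap_bracket, Matrix.single_mul_single_same, Matrix.single_mul_single_same,
    mul_add, Matrix.trace_add, mul_one, map_sub, mul_sub, Matrix.trace_sub,
    mul_assoc (lieMap P _) (polyMap P _), Matrix.trace_mul_comm (lieMap P _), mul_assoc] at h1
  linear_combination -h1

/-- Permuting the entries of a diagonal matrix is conjugation by a permutation matrix, which does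
not change the trace. -/
lemma rename_torusTrace (h : IsPolyRep P) (σ : Equiv.Perm (Fin n)) :
    MvPolynomial.rename σ (torusTrace P 1) = torusTrace P 1 := by
  refine mvPolynomial_ext_of_ne_zero fun t ht => ?_
  rw [MvPolynomial.eval_rename, eval_torusTrace, eval_torusTrace, mul_one, mul_one]
  have hdet : (σ.permMatrix ℂ).det ≠ 0 := by
    rw [Matrix.det_permutation]
    exact_mod_cast (Equiv.Perm.sign σ).ne_zero
  have hdet' : (σ⁻¹.permMatrix ℂ).det ≠ 0 := by
    rw [Matrix.det_permutation]
    exact_mod_cast (Equiv.Perm.sign σ⁻¹).ne_zero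
  have hinv : σ.permMatrix ℂ * σ⁻¹.permMatrix ℂ = 1 := by
    rw [← Matrix.permMatrix_mul, inv_mul_cancel, Matrix.permMatrix_one]
  have hinv' : σ⁻¹.permMatrix ℂ * σ.permMatrix ℂ = 1 := by
    rw [← Matrix.permMatrix_mul, mul_inv_cancel, Matrix.permMatrix_one]
  have hconj : (diagonal (t ∘ σ) : Matrix (Fin n) (Fin n) ℂ) =
      σ.permMatrix ℂ * (diagonal t * σ⁻¹.permMatrix ℂ) := by
    have h1 : (diagonal (t ∘ σ) : Matrix (Fin n) (Fin n) ℂ) * σ.permMatrix ℂ =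
        σ.permMatrix ℂ * diagonal t := by
      ext a b
      rw [Matrix.diagonal_mul, Matrix.mul_diagonal]
      by_cases hab : σ a = b
      · subst hab; simp [Equiv.Perm.permMatrix, PEquiv.toMatrix_apply, mul_comm]
      · simp [Equiv.Perm.permMatrix, PEquiv.toMatrix_apply, hab]
    rw [← mul_assoc, ← h1, mul_assoc, hinv, mul_one]
  have hd := det_diagonal_ne_zero ht
  rw [hconj, h.map_mul _ _ hdet (by rw [det_mul]; exact mul_ne_zero hd hdet'),
    h.map_mul _ _ hd hdet', Matrix.trace_mul_comm, mul_assoc, ← h.map_mul _ _ hdet' hdet, hinv',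
    h.map_one, mul_one]

end IsPolyRep

end

/-! ### The Casimir operator of `GL₄` as a Laplacian -/

section Four

variable {d : ℕ} {P : Matrix (Fin d) (Fin d) (MvPolynomial (Fin 4 × Fin 4) ℂ)}

/-- The Vandermonde product in four variables. -/
def vandermondeFour : MvPolynomial (Fin 4) ℂ :=
  (MvPolynomial.X 0 - MvPolynomial.X 1) * (MvPolynomial.X 0 - MvPolynomial.X 2) *
    (MvPolynomial.X 0 - MvPolynomial.X 3) * (MvPolynomial.X 1 - MvPolynomial.X 2) *
    (MvPolynomial.X 1 - MvPolynomial.X 3) * (MvPolynomial.X 2 - MvPolynomial.X 3)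

/-- Normal ordering: raising operators are brought to the right, where they kill a highest weight
vector. The commutators add up to the sum `(3, 1, -1, -3)` of the positive roots. -/
lemma IsPolyRep.casimir_four (h : IsPolyRep P) : casimir P =
    (∑ i, lieMap P (Matrix.single i i 1) * lieMap P (Matrix.single i i 1)) +
    (3 : ℂ) • lieMap P (Matrix.single 0 0 1) + lieMap P (Matrix.single 1 1 1) -
    lieMap P (Matrix.single 2 2 1) - (3 : ℂ) • lieMap P (Matrix.single 3 3 1) +
    (2 : ℂ) • (lieMap P (Matrix.single 1 0 1) * lieMap P (Matrix.single 0 1 1) +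
      lieMap P (Matrix.single 2 0 1) * lieMap P (Matrix.single 0 2 1) +
      lieMap P (Matrix.single 3 0 1) * lieMap P (Matrix.single 0 3 1) +
      lieMap P (Matrix.single 2 1 1) * lieMap P (Matrix.single 1 2 1) +
      lieMap P (Matrix.single 3 1 1) * lieMap P (Matrix.single 1 3 1) +
      lieMap P (Matrix.single 3 2 1) * lieMap P (Matrix.single 2 3 1)) := by
  have e : ∀ i j : Fin 4, lieMap P (Matrix.single i j 1) * lieMap P (Matrix.single j i 1) =
      lieMap P (Matrix.single j i 1) * lieMap P (Matrix.single i j 1) +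
      (lieMap P (Matrix.single i i 1) - lieMap P (Matrix.single j j 1)) := fun i j => by
    rw [h.lieMap_bracket, Matrix.single_mul_single_same, Matrix.single_mul_single_same, mul_one,
      map_sub]
  simp only [casimir, Fin.sum_univ_four]
  rw [e 0 1, e 0 2, e 0 3, e 1 2, e 1 3, e 2 3]
  module

lemma IsHighestVec.casimir_mulVec {l : Fin 4 → ℤ} {v : Fin d → ℂ} (h : IsPolyRep P)
    (hv : IsHighestVec P l v) : casimir P *ᵥ v =
      ((l 0 ^ 2 + l 1 ^ 2 + l 2 ^ 2 + l 3 ^ 2 + 3 * l 0 + l 1 - l 2 - 3 * l 3 : ℤ) : ℂ) • v := by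
  have hz : ∀ i j : Fin 4, i < j →
      (lieMap P (Matrix.single j i 1) * lieMap P (Matrix.single i j 1)) *ᵥ v = 0 := fun i j hij => by
    rw [← mulVec_mulVec, hv.lieMap_mulVec_eq_zero h hij, mulVec_zero]
  have hh := h.lieMap_single_self_mulVec hv.isWeightVec
  rw [h.casimir_four]
  simp only [add_mulVec, sub_mulVec, smul_mulVec, Fin.sum_univ_four, hh,
    hz 0 1 (by decide), hz 0 2 (by decide), hz 0 3 (by decide), hz 1 2 (by decide),
    hz 1 3 (by decide), hz 2 3 (by decide), ← mulVec_mulVec, mulVec_smul]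
  push_cast
  module

lemma euler_euler_mul (i : Fin 4) (p q : MvPolynomial (Fin 4) ℂ) :
    euler i (euler i (p * q)) = euler i (euler i p) * q + 2 * (euler i p * euler i q) +
      p * euler i (euler i q) := by
  simp only [Derivation.leibniz, map_add, smul_eq_mul]
  ring

lemma euler_vandermondeFour :
    (∀ i, euler i vandermondeFour = (match i with
      | 0 => MvPolynomial.X 0 * ((MvPolynomial.X 1 - MvPolynomial.X 2) *
          (MvPolynomial.X 1 - MvPolynomial.X 3) * (MvPolynomial.X 2 - MvPolynomial.X 3) *
        ((MvPolynomial.X 0 - MvPolynomial.X 1) * (MvPolynomial.X 0 - MvPolynomial.X 2) +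
         (MvPolynomial.X 0 - MvPolynomial.X 1) * (MvPolynomial.X 0 - MvPolynomial.X 3) +
         (MvPolynomial.X 0 - MvPolynomial.X 2) * (MvPolynomial.X 0 - MvPolynomial.X 3)))
      | 1 => MvPolynomial.X 1 * ((MvPolynomial.X 0 - MvPolynomial.X 2) *
          (MvPolynomial.X 0 - MvPolynomial.X 3) * (MvPolynomial.X 2 - MvPolynomial.X 3) *
        (-((MvPolynomial.X 1 - MvPolynomial.X 2) * (MvPolynomial.X 1 - MvPolynomial.X 3)) +
         (MvPolynomial.X 0 - MvPolynomial.X 1) * (MvPolynomial.X 1 - MvPolynomial.X 3) +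
         (MvPolynomial.X 0 - MvPolynomial.X 1) * (MvPolynomial.X 1 - MvPolynomial.X 2)))
      | 2 => MvPolynomial.X 2 * ((MvPolynomial.X 0 - MvPolynomial.X 1) *
          (MvPolynomial.X 0 - MvPolynomial.X 3) * (MvPolynomial.X 1 - MvPolynomial.X 3) *
        (-((MvPolynomial.X 1 - MvPolynomial.X 2) * (MvPolynomial.X 2 - MvPolynomial.X 3)) -
         (MvPolynomial.X 0 - MvPolynomial.X 2) * (MvPolynomial.X 2 - MvPolynomial.X 3) +
         (MvPolynomial.X 0 - MvPolynomial.X 2) * (MvPolynomial.X 1 - MvPolynomial.X 2)))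
      | 3 => -(MvPolynomial.X 3 * ((MvPolynomial.X 0 - MvPolynomial.X 1) *
          (MvPolynomial.X 0 - MvPolynomial.X 2) * (MvPolynomial.X 1 - MvPolynomial.X 2) *
        ((MvPolynomial.X 1 - MvPolynomial.X 3) * (MvPolynomial.X 2 - MvPolynomial.X 3) +
         (MvPolynomial.X 0 - MvPolynomial.X 3) * (MvPolynomial.X 2 - MvPolynomial.X 3) +
         (MvPolynomial.X 0 - MvPolynomial.X 3) * (MvPolynomial.X 1 - MvPolynomial.X 3)))) :
          MvPolynomial (Fin 4) ℂ)) := by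
  intro i
  fin_cases i <;>
  · simp [vandermondeFour, Derivation.leibniz, euler_X]
    ring

/-- The exponents in the Vandermonde product are the permutations of `(3, 2, 1, 0)`, and `14 = 9 + 4
+ 1 + 0`. -/
lemma sum_euler_euler_vandermondeFour :
    ∑ i, euler i (euler i vandermondeFour) = 14 * vandermondeFour := by
  simp only [Fin.sum_univ_four, euler_vandermondeFour]
  simp [vandermondeFour, Derivation.leibniz, euler_X]
  ring

/-- The Laplacian of the product of the Vandermonde product and the character. -/
lemma sum_euler_euler_vandermonde_mul (h : IsPolyRep P) {c : ℂ}
    (hc : casimir P = c • (1 : Matrix (Fin d) (Fin d) ℂ)) {k : ℂ}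
    (hk : ∑ i, euler i (torusTrace P 1) = k • torusTrace P 1) :
    ∑ i, euler i (euler i (vandermondeFour * torusTrace P 1)) =
      (c + 14 + 3 * k) • (vandermondeFour * torusTrace P 1) := by
  have h1 := congrArg (torusTrace P) (h.casimir_four.symm.trans hc)
  simp only [Fin.sum_univ_four, map_add, map_sub, map_smul, h.torusTrace_mul_lieMap,
    h.torusTrace_lieMap] at h1
  have h2 := sum_euler_euler_vandermondeFour
  simp only [Fin.sum_univ_four] at h2 hk
  simp only [Fin.sum_univ_four, euler_euler_mul, euler_vandermondeFour,
    MvPolynomial.smul_eq_C_mul] at *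
  have t01 := h.torusTrace_root (i := 0) (j := 1)
  have t02 := h.torusTrace_root (i := 0) (j := 2)
  have t03 := h.torusTrace_root (i := 0) (j := 3)
  have t12 := h.torusTrace_root (i := 1) (j := 2)
  have t13 := h.torusTrace_root (i := 1) (j := 3)
  have t23 := h.torusTrace_root (i := 2) (j := 3)
  simp only [map_add, map_mul, map_ofNat] at h1 ⊢
  generalize torusTrace P (lieMap P (single 1 0 1) * lieMap P (single 0 1 1)) = T01 at *
  generalize torusTrace P (lieMap P (single 2 0 1) * lieMap P (single 0 2 1)) = T02 at *
  generalize torusTrace P (lieMap P (single 3 0 1) * lieMap P (single 0 3 1)) = T03 at *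
  generalize torusTrace P (lieMap P (single 2 1 1) * lieMap P (single 1 2 1)) = T12 at *
  generalize torusTrace P (lieMap P (single 3 1 1) * lieMap P (single 1 3 1)) = T13 at *
  generalize torusTrace P (lieMap P (single 3 2 1) * lieMap P (single 2 3 1)) = T23 at *
  generalize torusTrace P 1 = Q at *
  rw [vandermondeFour] at *
  generalize (MvPolynomial.X : Fin 4 → MvPolynomial (Fin 4) ℂ) = x at *
  -- Each root identity is multiplied by the Vandermonde product without the factor `x i - x j`;
  -- together they match the cross terms of the product rule. The multiple 3 of `hk` arises because
  -- `2 (3, 2, 1, 0) = (3, 1, -1, -3) + 3 (1, 1, 1, 1)`.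
  linear_combination Q * h2 + ((x 0 - x 1) * (x 0 - x 2) * (x 0 - x 3) * (x 1 - x 2) * (x 1 - x 3) * (x 2 - x 3)) * h1 + 3 * ((x 0 - x 1) * (x 0 - x 2) * (x 0 - x 3) * (x 1 - x 2) * (x 1 - x 3) * (x 2 - x 3)) * hk -
    2 * ((x 0 - x 2) * (x 0 - x 3) * (x 1 - x 2) * (x 1 - x 3) * (x 2 - x 3)) * t01 -
    2 * ((x 0 - x 1) * (x 0 - x 3) * (x 1 - x 2) * (x 1 - x 3) * (x 2 - x 3)) * t02 -
    2 * ((x 0 - x 1) * (x 0 - x 2) * (x 1 - x 2) * (x 1 - x 3) * (x 2 - x 3)) * t03 -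
    2 * ((x 0 - x 1) * (x 0 - x 2) * (x 0 - x 3) * (x 1 - x 3) * (x 2 - x 3)) * t12 -
    2 * ((x 0 - x 1) * (x 0 - x 2) * (x 0 - x 3) * (x 1 - x 2) * (x 2 - x 3)) * t13 -
    2 * ((x 0 - x 1) * (x 0 - x 2) * (x 0 - x 3) * (x 1 - x 2) * (x 1 - x 3)) * t23

end Four

end ZeroWeight
end

/-! ### Alternants and antisymmetric polynomials -/

noncomputable section

namespace ZeroWeight

section Alternant

variable {n : ℕ}

/-- The alternant `det (X i ^ L j)`. -/
def altPoly (L : Fin n → ℕ) : MvPolynomial (Fin n) ℂ :=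
  (Matrix.of fun i j => (MvPolynomial.X i : MvPolynomial (Fin n) ℂ) ^ L j).det

lemma altPoly_eq_sum (L : Fin n → ℕ) : altPoly L = ∑ σ : Equiv.Perm (Fin n),
    MvPolynomial.monomial (Finsupp.equivFunOnFinite.symm (L ∘ σ.symm)) ((Equiv.Perm.sign σ : ℤ) : ℂ) := by
  rw [altPoly, Matrix.det_apply]
  refine Finset.sum_congr rfl fun σ _ => ?_
  have h1 : ∏ i, (MvPolynomial.X (σ i) : MvPolynomial (Fin n) ℂ) ^ L i =
      MvPolynomial.monomial (Finsupp.equivFunOnFinite.symm (L ∘ σ.symm)) 1 := by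
    rw [MvPolynomial.monomial_eq, Finsupp.prod_fintype _ _ fun _ => pow_zero _,
      ← Equiv.prod_comp σ fun i => MvPolynomial.X i ^
        (Finsupp.equivFunOnFinite.symm (L ∘ σ.symm)) i]
    simp
  simp only [Matrix.of_apply, h1]
  rcases Int.units_eq_one_or (Equiv.Perm.sign σ) with h | h <;> simp [h]

lemma exists_perm_of_coeff_altPoly_ne_zero {L : Fin n → ℕ} {s : Fin n →₀ ℕ}
    (h : MvPolynomial.coeff s (altPoly L) ≠ 0) : ∃ σ : Equiv.Perm (Fin n), ∀ i, s (σ i) = L i := by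
  rw [altPoly_eq_sum, MvPolynomial.coeff_sum] at h
  obtain ⟨σ, _, hσ⟩ := Finset.exists_ne_zero_of_sum_ne_zero h
  rw [MvPolynomial.coeff_monomial] at hσ
  refine ⟨σ, fun i => ?_⟩
  split_ifs at hσ with hs
  · rw [← hs]; simp
  · exact absurd rfl hσ

/-- The permutation is strictly increasing, and the identity is the only such permutation of `Fin
n`. -/
lemma perm_eq_one_of_strictAnti {L s : Fin n → ℕ} (hL : StrictAnti L) (hs : StrictAnti s)
    {σ : Equiv.Perm (Fin n)} (h : ∀ i, s (σ i) = L i) : σ = 1 := by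
  have hm : StrictMono σ := fun i j hij => hs.lt_iff_gt.mp (by rw [h, h]; exact hL hij)
  have := (hm.range_inj strictMono_id).mp (by simp)
  exact Equiv.ext fun i => congrFun this i

lemma coeff_altPoly_self {L : Fin n → ℕ} (hL : StrictAnti L) :
    MvPolynomial.coeff (Finsupp.equivFunOnFinite.symm L) (altPoly L) = 1 := by
  rw [altPoly_eq_sum, MvPolynomial.coeff_sum, Finset.sum_eq_single 1]
  · rw [MvPolynomial.coeff_monomial, if_pos (by rfl)]
    simp
  · intro σ _ hσ
    rw [MvPolynomial.coeff_monomial, if_neg]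
    intro h
    refine hσ (perm_eq_one_of_strictAnti hL hL fun i => ?_)
    have := congrFun (Finsupp.equivFunOnFinite.symm.injective h) (σ i)
    simpa using this.symm
  · simp

/-- Antisymmetric polynomials. -/
def IsAntisymm (p : MvPolynomial (Fin n) ℂ) : Prop :=
  ∀ σ : Equiv.Perm (Fin n), MvPolynomial.rename σ p = ((Equiv.Perm.sign σ : ℤ) : ℂ) • p

lemma isAntisymm_altPoly (L : Fin n → ℕ) : IsAntisymm (altPoly L) := by
  intro σ
  have h1 : (MvPolynomial.rename σ).mapMatrix
      (Matrix.of fun i j => (MvPolynomial.X i : MvPolynomial (Fin n) ℂ) ^ L j) =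
      (Matrix.of fun i j => (MvPolynomial.X i : MvPolynomial (Fin n) ℂ) ^ L j).submatrix σ id := by
    ext i j
    simp
  rw [altPoly, AlgHom.map_det, h1, Matrix.det_permute, MvPolynomial.smul_eq_C_mul]
  simp

lemma IsAntisymm.coeff_comp {p : MvPolynomial (Fin n) ℂ} (hp : IsAntisymm p)
    (σ : Equiv.Perm (Fin n)) (s : Fin n → ℕ) :
    MvPolynomial.coeff (Finsupp.equivFunOnFinite.symm (s ∘ σ)) p =
      ((Equiv.Perm.sign σ : ℤ) : ℂ) * MvPolynomial.coeff (Finsupp.equivFunOnFinite.symm s) p := by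
  have h1 := MvPolynomial.coeff_rename_mapDomain σ σ.injective p
    (Finsupp.equivFunOnFinite.symm (s ∘ σ))
  have h2 : Finsupp.mapDomain σ (Finsupp.equivFunOnFinite.symm (s ∘ σ)) =
      Finsupp.equivFunOnFinite.symm s := by
    ext i
    obtain ⟨j, rfl⟩ := σ.surjective i
    rw [Finsupp.mapDomain_apply σ.injective]
    simp
  rw [h2, hp σ, MvPolynomial.coeff_smul, smul_eq_mul] at h1
  exact h1.symm

/-- A coefficient whose exponent has a repeated entry equals its own negative under a transposition,
so a nonzero coefficient has distinct exponents, and sorting them changes it only by a sign. -/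
lemma IsAntisymm.exists_strictAnti {p : MvPolynomial (Fin n) ℂ} (hp : IsAntisymm p) (h0 : p ≠ 0) :
    ∃ s : Fin n → ℕ, StrictAnti s ∧
      MvPolynomial.coeff (Finsupp.equivFunOnFinite.symm s) p ≠ 0 := by
  obtain ⟨r, hr⟩ := MvPolynomial.ne_zero_iff.mp h0
  obtain ⟨s, rfl⟩ := Finsupp.equivFunOnFinite.symm.surjective r
  have hinj : Function.Injective s := by
    intro i j hij
    by_contra hne
    have h1 := hp.coeff_comp (Equiv.swap i j) s
    have h2 : s ∘ Equiv.swap i j = s := by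
      funext k
      rcases eq_or_ne k i with rfl | hi
      · simp [hij]
      · rcases eq_or_ne k j with rfl | hj
        · simp [hij]
        · simp [Equiv.swap_apply_of_ne_of_ne hi hj]
    rw [h2, Equiv.Perm.sign_swap hne] at h1
    refine hr ?_
    push_cast at h1
    linear_combination h1 / 2
  have hmono := Tuple.monotone_sort (OrderDual.toDual ∘ s)
  set σ := Tuple.sort (OrderDual.toDual ∘ s) with hσ
  have hanti : Antitone (s ∘ σ) := fun i j hij => hmono hij
  refine ⟨s ∘ σ, hanti.strictAnti_of_injective (hinj.comp σ.injective), ?_⟩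
  rw [hp.coeff_comp σ s]
  refine mul_ne_zero ?_ hr
  exact_mod_cast (Equiv.Perm.sign σ).ne_zero

end Alternant

/-! ### The Weyl character formula for `GL₄` -/

section Four

variable {d : ℕ} {P : Matrix (Fin d) (Fin d) (MvPolynomial (Fin 4 × Fin 4) ℂ)}
  {l : Fin 4 → ℤ} {v : Fin d → ℂ}

lemma vandermondeFour_eq_altPoly : vandermondeFour = altPoly ![3, 2, 1, 0] := by
  rw [altPoly, Matrix.det_succ_row_zero, vandermondeFour]
  simp [Fin.sum_univ_succ, Matrix.det_fin_three, Fin.succAbove]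
  ring

/-- The dominance order, together with the strict inequality in case of nonequality. -/
def Dominated (μ l : Fin 4 → ℤ) : Prop :=
  μ 0 ≤ l 0 ∧ μ 0 + μ 1 ≤ l 0 + l 1 ∧ μ 0 + μ 1 + μ 2 ≤ l 0 + l 1 + l 2 ∧
    μ 0 + μ 1 + μ 2 + μ 3 = l 0 + l 1 + l 2 + l 3

lemma LowerWord.dominated {μ : Fin 4 → ℤ} {w : Fin d → ℂ} (hw : LowerWord P l v μ w) :
    Dominated μ l ∧ ((μ = l ∧ w = v) ∨ μ ≠ l) := by
  -- The functional `(3, 2, 1, 0)` is positive on every positive root, so it drops strictly with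
  -- each lowering operator; only the empty word keeps the weight `l`.
  have key : Dominated μ l ∧ ((μ = l ∧ w = v) ∨
      3 * μ 0 + 2 * μ 1 + μ 2 < 3 * l 0 + 2 * l 1 + l 2) := by
    induction hw with
    | base => exact ⟨⟨le_rfl, le_rfl, le_rfl, rfl⟩, Or.inl ⟨rfl, rfl⟩⟩
    | @step μ w i j hij hw ih =>
      obtain ⟨⟨h1, h2, h3, h4⟩, h5⟩ := ih
      have h6 : 3 * μ 0 + 2 * μ 1 + μ 2 ≤ 3 * l 0 + 2 * l 1 + l 2 := by omega
      unfold Dominated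
      fin_cases i <;> fin_cases j <;> simp_all <;> omega
  refine ⟨key.1, key.2.imp_right fun h e => ?_⟩
  rw [e] at h
  exact lt_irrefl _ h

namespace IsHighestVec

lemma dominated_of_weightMat_ne_zero (h : IsPolyRep P) (hirr : IsIrreduciblePoly P)
    (hv : IsHighestVec P l v) {s : Fin 4 →₀ ℕ} (hs : weightMat P s ≠ 0) :
    Dominated (fun i => (s i : ℤ)) l := by
  by_contra hnot
  refine hs (hv.matrix_ext h hirr fun μ w hw => ?_)
  rw [zero_mulVec]
  refine h.weightMat_mulVec_of_ne (hw.isWeightVec h hv) fun e => hnot ?_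
  rw [e]
  exact hw.dominated.1

lemma exists_nat_weight (h : IsPolyRep P) (hv : IsHighestVec P l v) :
    ∃ s : Fin 4 →₀ ℕ, (fun i => (s i : ℤ)) = l := by
  by_contra hnot
  refine hv.ne_zero ?_
  have h1 : (∑ r ∈ weightSupp P, weightMat P r) *ᵥ v = v := by rw [h.sum_weightMat, one_mulVec]
  rw [← h1, Matrix.sum_mulVec]
  exact Finset.sum_eq_zero fun s _ =>
    h.weightMat_mulVec_of_ne hv.isWeightVec fun e => hnot ⟨s, e⟩

/-- Among the spanning words only the empty one has the highest weight, so `weightMat P m` is a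
projection onto the line of `v`. -/
lemma trace_weightMat (h : IsPolyRep P) (hirr : IsIrreduciblePoly P)
    {m : Fin 4 →₀ ℕ} (hv : IsHighestVec P (fun i => (m i : ℤ)) v) : (weightMat P m).trace = 1 := by
  have hproj : LinearMap.IsProj (Submodule.span ℂ {v}) (Matrix.toLin' (weightMat P m)) := by
    constructor
    · intro x
      have hx : x ∈ wordSpan P (fun i => (m i : ℤ)) v := by
        rw [hv.wordSpan_eq_top h hirr]
        trivial
      rw [Matrix.toLin'_apply]
      induction hx using Submodule.span_induction with
      | mem w hw =>
        obtain ⟨μ, hw⟩ := hw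
        rcases hw.dominated.2 with ⟨rfl, rfl⟩ | hne
        · rw [h.weightMat_mulVec_of_eq (hw.isWeightVec h hv)]
          exact Submodule.mem_span_singleton_self w
        · rw [h.weightMat_mulVec_of_ne (hw.isWeightVec h hv) hne.symm]
          exact Submodule.zero_mem _
      | zero => simp
      | add x y _ _ hx hy =>
        rw [mulVec_add]
        exact add_mem hx hy
      | smul c x _ hx =>
        rw [mulVec_smul]
        exact Submodule.smul_mem _ c hx
    · intro x hx
      obtain ⟨c, rfl⟩ := Submodule.mem_span_singleton.mp hx
      rw [map_smul, Matrix.toLin'_apply, h.weightMat_mulVec_of_eq hv.isWeightVec]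
  have := hproj.trace
  rw [finrank_span_singleton hv.ne_zero, Matrix.trace_toLin'_eq] at this
  simpa using this

/-- **Weyl character formula** for `GL₄`. -/
theorem vandermondeFour_mul_torusTrace (h : IsPolyRep P) (hirr : IsIrreduciblePoly P)
    {m : Fin 4 →₀ ℕ} (hv : IsHighestVec P (fun i => (m i : ℤ)) v) (hm : Antitone m) :
    vandermondeFour * torusTrace P 1 = altPoly (⇑m + ![3, 2, 1, 0]) := by
  have hdom : ∀ s, MvPolynomial.coeff s (torusTrace P 1) ≠ 0 →
      Dominated (fun i => (s i : ℤ)) (fun i => (m i : ℤ)) := fun s hs => by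
    refine hv.dominated_of_weightMat_ne_zero h hirr fun h0 => hs ?_
    rw [coeff_torusTrace, h0, zero_mul, Matrix.trace_zero]
  have hk : ∑ i, euler i (torusTrace P 1) =
      ((m 0 : ℂ) + m 1 + m 2 + m 3) • torusTrace P 1 := by
    ext s
    rw [MvPolynomial.coeff_sum, MvPolynomial.coeff_smul]
    simp only [coeff_euler, Fin.sum_univ_four, smul_eq_mul]
    by_cases hs : MvPolynomial.coeff s (torusTrace P 1) = 0
    · simp [hs]
    · have h1 : (s 0 : ℤ) + s 1 + s 2 + s 3 = m 0 + m 1 + m 2 + m 3 := (hdom s hs).2.2.2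
      have h2 : (s 0 : ℂ) + s 1 + s 2 + s 3 = m 0 + m 1 + m 2 + m 3 := by exact_mod_cast h1
      linear_combination h2 * MvPolynomial.coeff s (torusTrace P 1)
  have hlap := sum_euler_euler_vandermonde_mul h (hv.casimir_eq h hirr (hv.casimir_mulVec h)) hk
  -- Monomials are eigenvectors of the Laplacian, with the squared norm of the exponent as
  -- eigenvalue; `c + 14 + 3k` is the squared norm of `m + (3, 2, 1, 0)`.
  have hnorm : ∀ s, MvPolynomial.coeff s (vandermondeFour * torusTrace P 1) ≠ 0 →
      (s 0 : ℤ) ^ 2 + s 1 ^ 2 + s 2 ^ 2 + s 3 ^ 2 =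
        (m 0 + 3) ^ 2 + (m 1 + 2) ^ 2 + (m 2 + 1) ^ 2 + m 3 ^ 2 := fun s hs => by
    have h1 := congrArg (MvPolynomial.coeff s) hlap
    rw [MvPolynomial.coeff_sum, MvPolynomial.coeff_smul] at h1
    simp only [coeff_euler, Fin.sum_univ_four, smul_eq_mul] at h1
    have h2 : ((s 0 : ℂ) ^ 2 + s 1 ^ 2 + s 2 ^ 2 + s 3 ^ 2) =
        (m 0 + 3) ^ 2 + (m 1 + 2) ^ 2 + (m 2 + 1) ^ 2 + m 3 ^ 2 := by
      refine mul_right_cancel₀ hs ?_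
      push_cast at h1
      linear_combination h1
    exact_mod_cast h2
  have hsplit : ∀ s μ r : Fin 4 →₀ ℕ, μ + r = s →
      MvPolynomial.coeff μ (altPoly ![3, 2, 1, 0] : MvPolynomial (Fin 4) ℂ) *
        MvPolynomial.coeff r (torusTrace P 1) ≠ 0 →
      Dominated (fun i => (r i : ℤ)) (fun i => (m i : ℤ)) ∧ μ 0 ≤ 3 ∧ μ 0 + μ 1 ≤ 5 ∧
        μ 0 + μ 1 + μ 2 ≤ 6 ∧ μ 0 + μ 1 + μ 2 + μ 3 = 6 := fun s μ r hs hne => by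
    refine ⟨hdom r (right_ne_zero_of_mul hne), ?_⟩
    obtain ⟨σ, hσ⟩ := exists_perm_of_coeff_altPoly_ne_zero (left_ne_zero_of_mul hne)
    have hμ : ∀ j, μ j = (![3, 2, 1, 0] : Fin 4 → ℕ) (σ.symm j) := fun j => by
      rw [← hσ, Equiv.apply_symm_apply]
    simp only [hμ]
    clear hμ hσ
    generalize σ.symm = τ
    revert τ
    decide
  -- By dominance in both factors, the top exponent arises only from the two top terms, each with
  -- coefficient 1.
  have hself : MvPolynomial.coeff (Finsupp.equivFunOnFinite.symm (⇑m + ![3, 2, 1, 0]))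
      (vandermondeFour * torusTrace P 1) = 1 := by
    rw [vandermondeFour_eq_altPoly, MvPolynomial.coeff_mul, Finset.sum_eq_single
      (Finsupp.equivFunOnFinite.symm ![3, 2, 1, 0], m)]
    · rw [coeff_altPoly_self (by decide), coeff_torusTrace, mul_one, one_mul,
        hv.trace_weightMat h hirr]
    · rintro ⟨μ, r⟩ hmem hne
      by_contra h0
      rw [Finset.HasAntidiagonal.mem_antidiagonal] at hmem
      obtain ⟨⟨a1, a2, a3, a4⟩, b1, b2, b3, b4⟩ := hsplit _ μ r hmem h0
      have e0 : μ 0 + r 0 = m 0 + 3 := DFunLike.congr_fun hmem 0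
      have e1 : μ 1 + r 1 = m 1 + 2 := DFunLike.congr_fun hmem 1
      have e2 : μ 2 + r 2 = m 2 + 1 := DFunLike.congr_fun hmem 2
      have e3 : μ 3 + r 3 = m 3 + 0 := DFunLike.congr_fun hmem 3
      simp at a1 a2 a3 a4
      refine hne ?_
      rw [Prod.mk.injEq]
      constructor
      · ext i
        fin_cases i <;> simp <;> omega
      · ext i
        fin_cases i <;> simp <;> omega
    · intro hnot
      exfalso
      refine hnot ?_
      rw [Finset.HasAntidiagonal.mem_antidiagonal]
      ext i
      exact add_comm _ _
  have hLanti : StrictAnti (⇑m + ![3, 2, 1, 0]) := by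
    have h3 : StrictAnti (![3, 2, 1, 0] : Fin 4 → ℕ) := by decide
    exact fun i j hij => add_lt_add_of_le_of_lt (hm hij.le) (h3 hij)
  -- The difference of the two sides is antisymmetric. If nonzero, it has a strictly decreasing
  -- exponent `s`; dominance and the norm force `s = m + (3, 2, 1, 0)`, where both coefficients are
  -- 1.
  rw [← sub_eq_zero]
  by_contra hne
  have hanti : IsAntisymm (vandermondeFour * torusTrace P 1 - altPoly (⇑m + ![3, 2, 1, 0])) := by
    intro σ
    rw [map_sub, map_mul, h.rename_torusTrace, vandermondeFour_eq_altPoly, isAntisymm_altPoly,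
      isAntisymm_altPoly, smul_mul_assoc, smul_sub]
  obtain ⟨s, hs, hcoeff⟩ := hanti.exists_strictAnti hne
  have hsL : s = ⇑m + ![3, 2, 1, 0] := by
    by_cases h0 : MvPolynomial.coeff (Finsupp.equivFunOnFinite.symm s)
        (vandermondeFour * torusTrace P 1) = 0
    · rw [MvPolynomial.coeff_sub, h0, zero_sub, neg_ne_zero] at hcoeff
      obtain ⟨σ, hσ⟩ := exists_perm_of_coeff_altPoly_ne_zero hcoeff
      have h1 := perm_eq_one_of_strictAnti hLanti hs (σ := σ) (by simpa using hσ)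
      funext i
      rw [← hσ i, h1]
      rfl
    · have hn := hnorm _ h0
      rw [vandermondeFour_eq_altPoly, MvPolynomial.coeff_mul] at h0
      obtain ⟨⟨μ, r⟩, hmem, hne⟩ := Finset.exists_ne_zero_of_sum_ne_zero h0
      rw [Finset.HasAntidiagonal.mem_antidiagonal] at hmem
      obtain ⟨⟨a1, a2, a3, a4⟩, b1, b2, b3, b4⟩ := hsplit _ μ r hmem hne
      have e0 : μ 0 + r 0 = s 0 := DFunLike.congr_fun hmem 0
      have e1 : μ 1 + r 1 = s 1 := DFunLike.congr_fun hmem 1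
      have e2 : μ 2 + r 2 = s 2 := DFunLike.congr_fun hmem 2
      have e3 : μ 3 + r 3 = s 3 := DFunLike.congr_fun hmem 3
      have s1 : s 1 < s 0 := hs (by decide)
      have s2 : s 2 < s 1 := hs (by decide)
      have s3 : s 3 < s 2 := hs (by decide)
      have m1 : m 1 ≤ m 0 := hm (by decide)
      have m2 : m 2 ≤ m 1 := hm (by decide)
      have m3 : m 3 ≤ m 2 := hm (by decide)
      simp at a1 a2 a3 a4 hn
      -- Put `M = m + (3, 2, 1, 0)`. Equality of norms reads `∑ (Mᵢ - sᵢ)(Mᵢ + sᵢ) = 0`. Summation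
      -- by parts writes this as a sum of the partial sums of `M - s`, nonnegative by dominance,
      -- times the gaps of `M + s`, which are at least 1. So all partial sums vanish.
      have d1 : (0 : ℤ) ≤ m 0 + 3 - s 0 := by omega
      have d2 : (0 : ℤ) ≤ m 0 + 3 - s 0 + (m 1 + 2 - s 1) := by omega
      have d3 : (0 : ℤ) ≤ m 0 + 3 - s 0 + (m 1 + 2 - s 1) + (m 2 + 1 - s 2) := by omega
      have d4 : (m 0 + 3 - s 0 + (m 1 + 2 - s 1) + (m 2 + 1 - s 2) + (m 3 - s 3) : ℤ) = 0 := by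
        omega
      have g1 : (1 : ℤ) ≤ (m 0 + 3 + s 0) - (m 1 + 2 + s 1) := by omega
      have g2 : (1 : ℤ) ≤ (m 1 + 2 + s 1) - (m 2 + 1 + s 2) := by omega
      have g3 : (1 : ℤ) ≤ (m 2 + 1 + s 2) - (m 3 + s 3) := by omega
      have k1 := le_mul_of_one_le_right d1 g1
      have k2 := le_mul_of_one_le_right d2 g2
      have k3 := le_mul_of_one_le_right d3 g3
      have k4 : (m 0 + 3 - s 0 : ℤ) * ((m 0 + 3 + s 0) - (m 1 + 2 + s 1)) +
          (m 0 + 3 - s 0 + (m 1 + 2 - s 1)) * ((m 1 + 2 + s 1) - (m 2 + 1 + s 2)) +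
          (m 0 + 3 - s 0 + (m 1 + 2 - s 1) + (m 2 + 1 - s 2)) *
            ((m 2 + 1 + s 2) - (m 3 + s 3)) = 0 := by
        linear_combination -hn - (m 3 + s 3 : ℤ) * d4
      funext i
      fin_cases i <;> simp <;> omega
  rw [hsL, MvPolynomial.coeff_sub, hself, coeff_altPoly_self hLanti, sub_self] at hcoeff
  exact hcoeff rfl

end IsHighestVec

end Four

end ZeroWeight
end

/-! ### Counting Gelfand–Tsetlin patterns of weight zero -/

noncomputable section

namespace ZeroWeight

section Count

lemma sum_Ico_int_telescope (f F : ℤ → ℝ) {p q : ℤ} (hpq : p ≤ q)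
    (h : ∀ x, p ≤ x → x < q → f x = F (x + 1) - F x) : ∑ x ∈ Finset.Ico p q, f x = F q - F p := by
  induction q, hpq using Int.leInduction with
  | base => simp
  | succ q hpq ih =>
    rw [← Finset.insert_Ico_right_eq_Ico_add_one hpq, Finset.sum_insert (by simp),
      ih fun x h1 h2 => h x h1 (by omega), h q hpq (by omega)]
    ring

lemma sum_Ico_int_consecutive (f : ℤ → ℝ) {p q r : ℤ} (hpq : p ≤ q) (hqr : q ≤ r) :
    ∑ x ∈ Finset.Ico p r, f x = ∑ x ∈ Finset.Ico p q, f x + ∑ x ∈ Finset.Ico q r, f x := by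
  rw [← Finset.Ico_union_Ico_eq_Ico hpq hqr,
    Finset.sum_union (Finset.Ico_disjoint_Ico_consecutive p q r)]

/-- The number of Gelfand–Tsetlin patterns of weight zero with third row `(a, b, -a - b)`. -/
def patternWeight (a b : ℤ) : ℤ := if 0 ≤ b then a - b + 1 else a + 2 * b + 1

/-- The number of Gelfand–Tsetlin patterns of weight zero with top row `l` and middle entry `b`
of the third row. -/
def patternSum (l : Fin 4 → ℤ) (b : ℤ) : ℝ :=
  ∑ a ∈ Finset.Ico (l 1) (l 0 + 1),
    if l 3 ≤ -a - b ∧ -a - b ≤ l 2 then (patternWeight a b : ℝ) else 0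

/-- The number of Gelfand–Tsetlin patterns of weight zero with top row `l`. -/
def patternCount (l : Fin 4 → ℤ) : ℝ := ∑ b ∈ Finset.Ico (l 2) (l 1 + 1), patternSum l b

/-- Antidifference in `b` of the antidifference in `x = u + v b` of `x + 1 + s b`. -/
def cubicAntidiff (s u v b : ℝ) : ℝ :=
  (v ^ 2 / 2 + s * v) * (b * (b - 1) * (2 * b - 1) / 6) +
    (u * v + v / 2 + s * u) * (b * (b - 1) / 2) + (u ^ 2 / 2 + u / 2) * b

lemma sum_patternSum_eq_zero {l : Fin 4 → ℤ} {p q : ℤ}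
    (h : ∀ b, p ≤ b → b < q → ∀ a, l 1 ≤ a → a < l 0 + 1 →
      ¬(l 3 ≤ -a - b ∧ -a - b ≤ l 2)) : ∑ b ∈ Finset.Ico p q, patternSum l b = 0 := by
  refine Finset.sum_eq_zero fun b hb => Finset.sum_eq_zero fun a ha => ?_
  rw [Finset.mem_Ico] at ha hb
  rw [if_neg (h b hb.1 hb.2 a ha.1 ha.2)]

/-- On a range of `b` where the weight is affine and the admissible `a` form a half-open interval
with affine ends, summing over `a` and then over `b` telescopes. Since the upper end `u + v * b` is
excluded, it is one more than the largest admissible `a`. -/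
lemma sum_patternSum {l : Fin 4 → ℤ} {p q : ℤ} (s u v u' v' : ℤ) (hpq : p ≤ q)
    (hs : ∀ a b, p ≤ b → b < q → patternWeight a b = a + 1 + s * b)
    (hle : ∀ b, p ≤ b → b < q → u' + v' * b ≤ u + v * b)
    (hiff : ∀ b, p ≤ b → b < q → ∀ a, (l 1 ≤ a ∧ a < l 0 + 1) ∧ (l 3 ≤ -a - b ∧ -a - b ≤ l 2) ↔
      u' + v' * b ≤ a ∧ a < u + v * b) :
    ∑ b ∈ Finset.Ico p q, patternSum l b =
      (cubicAntidiff s u v q - cubicAntidiff s u' v' q) -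
        (cubicAntidiff s u v p - cubicAntidiff s u' v' p) := by
  refine sum_Ico_int_telescope _ (fun b => cubicAntidiff s u v b - cubicAntidiff s u' v' b) hpq
    fun b hb hb' => ?_
  have h1 : patternSum l b =
      ∑ a ∈ Finset.Ico (u' + v' * b) (u + v * b), (patternWeight a b : ℝ) := by
    rw [patternSum, ← Finset.sum_filter]
    congr 1
    ext a
    rw [Finset.mem_filter, Finset.mem_Ico, Finset.mem_Ico]
    exact hiff b hb hb' a
  rw [h1, sum_Ico_int_telescope _ (fun x => (x : ℝ) ^ 2 / 2 + x / 2 + s * b * x) (hle b hb hb')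
    fun x _ _ => by rw [hs x b hb hb']; push_cast; ring]
  simp only [cubicAntidiff]
  push_cast
  ring

/-- The slope in `b` is `-1` on this side and `2` on the other; the two formulas agree at `b = 0`,
so either may be used there. -/
lemma patternWeight_of_nonneg {a b : ℤ} (h : 0 ≤ b) : patternWeight a b = a + 1 + (-1) * b := by
  rw [patternWeight, if_pos h]; ring

lemma patternWeight_of_nonpos {a b : ℤ} (h : b ≤ 0) : patternWeight a b = a + 1 + 2 * b := by
  rw [patternWeight]
  split_ifs with h'
  · have : b = 0 := le_antisymm h h'
    rw [this]; ring
  · ring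

variable {l : Fin 4 → ℤ}

/-- Here `b ≤ 0` throughout, and the bounds on `-a - b` imply those on `a`: there are no
breakpoints. -/
lemma patternCount_region₁ (h12 : l 2 ≤ l 1) (h23 : l 3 ≤ l 2)
    (hsum : l 0 + l 1 + l 2 + l 3 = 0) (h1 : l 1 ≤ 0) :
    patternCount l = p₁ fun i => (l i : ℝ) := by
  rw [patternCount, sum_patternSum 2 (-l 3 + 1) (-1) (-l 2) (-1) (by omega)
    (fun a b _ hb => patternWeight_of_nonpos (by omega)) (fun b _ _ => by omega)
    (fun b _ _ a => by omega)]
  simp only [cubicAntidiff, p₁]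
  push_cast
  ring

/-- Here `b ≥ 0` throughout, and the bounds on `a` imply those on `-a - b`. -/
lemma patternCount_region₂ (h01 : l 1 ≤ l 0) (h12 : l 2 ≤ l 1)
    (hsum : l 0 + l 1 + l 2 + l 3 = 0) (h2 : 0 ≤ l 2) :
    patternCount l = p₂ fun i => (l i : ℝ) := by
  rw [patternCount, sum_patternSum (-1) (l 0 + 1) 0 (l 1) 0 (by omega)
    (fun a b hb _ => patternWeight_of_nonneg (by omega)) (fun b _ _ => by omega)
    (fun b _ _ a => by omega)]
  simp only [cubicAntidiff, p₂]
  push_cast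
  ring

/-- For `b < 0` the lower bound is `-l 2 - b`, while the upper bound changes from `l 0` to `-l 3 -
b` at `b = l 1 + l 2 ≤ 0`. For `b < l 1 + l 3` no `a` is admissible, yet the closed form stays the
same: it would count, with a minus sign, a triangle `b ≥ l 2`, `-a - b - 1 ≥ l 2`, `a ≥ l 0 + 1`,
and the weight `a + 2b + 1` is odd under the symmetry `b ↔ -a - b - 1` of that triangle. -/
lemma sum_patternSum_region₃_lower (h23 : l 3 ≤ l 2)
    (hsum : l 0 + l 1 + l 2 + l 3 = 0) (h1 : 0 < l 1) (h03 : 0 ≤ l 0 + l 3) :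
    ∑ b ∈ Finset.Ico (l 2) 0, patternSum l b =
      (cubicAntidiff 2 (l 0 + 1) 0 (l 1 + l 2) - cubicAntidiff 2 (-l 2) (-1) (l 1 + l 2)) -
      (cubicAntidiff 2 (l 0 + 1) 0 (l 2) - cubicAntidiff 2 (-l 2) (-1) (l 2)) +
      (-(cubicAntidiff 2 (-l 3 + 1) (-1) (l 1 + l 2) - cubicAntidiff 2 (-l 2) (-1) (l 1 + l 2))) := by
  rw [sum_Ico_int_consecutive _ (show l 2 ≤ l 1 + l 2 by omega) (show l 1 + l 2 ≤ 0 by omega),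
    sum_patternSum 2 (-l 3 + 1) (-1) (-l 2) (-1) (show l 1 + l 2 ≤ 0 by omega)
    (fun a b _ hb => patternWeight_of_nonpos (by omega)) (fun b _ _ => by omega)
    (fun b _ _ a => by omega)]
  have h3 : (l 3 : ℝ) = -l 0 - l 1 - l 2 := by
    have : l 3 = -l 0 - l 1 - l 2 := by omega
    rw [this]; push_cast; ring
  rcases le_total (l 1 + l 3) (l 2) with h | h
  · rw [sum_patternSum 2 (l 0 + 1) 0 (-l 2) (-1) (show l 2 ≤ l 1 + l 2 by omega)
      (fun a b _ hb => patternWeight_of_nonpos (by omega)) (fun b _ _ => by omega)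
      (fun b _ _ a => by omega)]
    simp only [cubicAntidiff]
    push_cast
    ring
  · rw [sum_Ico_int_consecutive _ h (show l 1 + l 3 ≤ l 1 + l 2 by omega),
      sum_patternSum_eq_zero fun b _ _ a _ _ => by omega,
      sum_patternSum 2 (l 0 + 1) 0 (-l 2) (-1) (show l 1 + l 3 ≤ l 1 + l 2 by omega)
      (fun a b _ hb => patternWeight_of_nonpos (by omega)) (fun b _ _ => by omega)
      (fun b _ _ a => by omega)]
    simp only [cubicAntidiff]
    push_cast
    rw [h3]
    ring

/-- The closed form ignores both the change of the lower bound to `l 1` at `b = -l 1 - l 2` and the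
absence of admissible `a` for `b > l 0 + l 2`. The triangles so miscounted are symmetric under `(a,
b) ↔ (b - 1, a + 1)`, for which the weight `a - b + 1` is odd. -/
lemma sum_patternSum_region₃_upper (h23 : l 3 ≤ l 2)
    (hsum : l 0 + l 1 + l 2 + l 3 = 0) (h1 : 0 < l 1) (h03 : 0 ≤ l 0 + l 3) :
    ∑ b ∈ Finset.Ico 0 (l 1 + 1), patternSum l b =
      cubicAntidiff (-1) (-l 3 + 1) (-1) (l 1 + 1) - cubicAntidiff (-1) (-l 2) (-1) (l 1 + 1) := by
  have h3 : (l 3 : ℝ) = -l 0 - l 1 - l 2 := by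
    have : l 3 = -l 0 - l 1 - l 2 := by omega
    rw [this]; push_cast; ring
  rcases le_total (l 1) (-l 1 - l 2) with h | h
  · rw [sum_patternSum (-1) (-l 3 + 1) (-1) (-l 2) (-1) (by omega)
      (fun a b hb _ => patternWeight_of_nonneg (by omega)) (fun b _ _ => by omega)
      (fun b _ _ a => by omega)]
    simp only [cubicAntidiff]
    push_cast
    ring
  · rw [sum_Ico_int_consecutive _ (show 0 ≤ -l 1 - l 2 by omega)
        (show -l 1 - l 2 ≤ l 1 + 1 by omega),
      sum_patternSum (-1) (-l 3 + 1) (-1) (-l 2) (-1) (show 0 ≤ -l 1 - l 2 by omega)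
      (fun a b hb _ => patternWeight_of_nonneg (by omega)) (fun b _ _ => by omega)
      (fun b _ _ a => by omega)]
    rcases le_total (l 1) (l 0 + l 2) with h' | h'
    · rw [sum_patternSum (-1) (-l 3 + 1) (-1) (l 1) 0 (show -l 1 - l 2 ≤ l 1 + 1 by omega)
        (fun a b hb _ => patternWeight_of_nonneg (by omega)) (fun b _ _ => by omega)
        (fun b _ _ a => by omega)]
      simp only [cubicAntidiff]
      push_cast
      ring
    · rw [sum_Ico_int_consecutive _ (show -l 1 - l 2 ≤ l 0 + l 2 + 1 by omega)
          (show l 0 + l 2 + 1 ≤ l 1 + 1 by omega),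
        sum_patternSum_eq_zero (p := l 0 + l 2 + 1) fun b _ _ a _ _ => by omega,
        sum_patternSum (-1) (-l 3 + 1) (-1) (l 1) 0 (show -l 1 - l 2 ≤ l 0 + l 2 + 1 by omega)
        (fun a b hb _ => patternWeight_of_nonneg (by omega)) (fun b _ _ => by omega)
        (fun b _ _ a => by omega)]
      simp only [cubicAntidiff]
      push_cast
      rw [h3]
      ring

lemma patternCount_region₃ (h23 : l 3 ≤ l 2)
    (hsum : l 0 + l 1 + l 2 + l 3 = 0) (h1 : 0 < l 1) (h2 : l 2 < 0) (h03 : 0 ≤ l 0 + l 3) :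
    patternCount l = p₃ fun i => (l i : ℝ) := by
  rw [patternCount, sum_Ico_int_consecutive _ h2.le (show 0 ≤ l 1 + 1 by omega),
    sum_patternSum_region₃_lower h23 hsum h1 h03,
    sum_patternSum_region₃_upper h23 hsum h1 h03]
  have h3 : (l 3 : ℝ) = -l 0 - l 1 - l 2 := by
    have : l 3 = -l 0 - l 1 - l 2 := by omega
    rw [this]; push_cast; ring
  simp only [cubicAntidiff, p₃, h3]
  ring

/-- Now `l 1 + l 2 ≥ 0`, so the breakpoint of the upper bound lies on this side of zero and the
lower bound is `l 1` throughout. The range `b > l 0 + l 2` again contributes nothing to the closed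
form. -/
lemma sum_patternSum_region₄_upper (h01 : l 1 ≤ l 0)
    (hsum : l 0 + l 1 + l 2 + l 3 = 0) (h2 : l 2 < 0) (h03 : l 0 + l 3 ≤ 0) :
    ∑ b ∈ Finset.Ico 0 (l 1 + 1), patternSum l b =
      (cubicAntidiff (-1) (l 0 + 1) 0 (l 1 + l 2) - cubicAntidiff (-1) (l 1) 0 (l 1 + l 2)) +
      (cubicAntidiff (-1) (-l 3 + 1) (-1) (l 1 + 1) - cubicAntidiff (-1) (l 1) 0 (l 1 + 1)) -
      (cubicAntidiff (-1) (-l 3 + 1) (-1) (l 1 + l 2) -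
        cubicAntidiff (-1) (l 1) 0 (l 1 + l 2)) := by
  have h3 : (l 3 : ℝ) = -l 0 - l 1 - l 2 := by
    have : l 3 = -l 0 - l 1 - l 2 := by omega
    rw [this]; push_cast; ring
  rw [sum_Ico_int_consecutive _ (show 0 ≤ l 1 + l 2 by omega) (show l 1 + l 2 ≤ l 1 + 1 by omega),
    sum_patternSum (-1) (l 0 + 1) 0 (l 1) 0 (show 0 ≤ l 1 + l 2 by omega)
    (fun a b hb _ => patternWeight_of_nonneg (by omega)) (fun b _ _ => by omega)
    (fun b _ _ a => by omega)]
  rcases le_total (l 1) (l 0 + l 2) with h' | h'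
  · rw [sum_patternSum (-1) (-l 3 + 1) (-1) (l 1) 0 (show l 1 + l 2 ≤ l 1 + 1 by omega)
      (fun a b hb _ => patternWeight_of_nonneg (by omega)) (fun b _ _ => by omega)
      (fun b _ _ a => by omega)]
    simp only [cubicAntidiff]
    push_cast
    ring
  · rw [sum_Ico_int_consecutive _ (show l 1 + l 2 ≤ l 0 + l 2 + 1 by omega)
        (show l 0 + l 2 + 1 ≤ l 1 + 1 by omega),
      sum_patternSum_eq_zero (p := l 0 + l 2 + 1) fun b _ _ a _ _ => by omega,
      sum_patternSum (-1) (-l 3 + 1) (-1) (l 1) 0 (show l 1 + l 2 ≤ l 0 + l 2 + 1 by omega)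
      (fun a b hb _ => patternWeight_of_nonneg (by omega)) (fun b _ _ => by omega)
      (fun b _ _ a => by omega)]
    simp only [cubicAntidiff]
    push_cast
    rw [h3]
    ring

/-- The upper bound is `l 0` throughout. Replacing the true lower bound by `l 1` adds a triangle on
which the weight `a + 2b + 1` is odd under `b ↔ -a - b - 1`, so all cases share one closed form. -/
lemma sum_patternSum_region₄_lower (h01 : l 1 ≤ l 0)
    (hsum : l 0 + l 1 + l 2 + l 3 = 0) (h1 : 0 < l 1) (h2 : l 2 < 0) (h03 : l 0 + l 3 ≤ 0) :
    ∑ b ∈ Finset.Ico (l 2) 0, patternSum l b =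
      -(cubicAntidiff 2 (l 0 + 1) 0 (l 2) - cubicAntidiff 2 (l 1) 0 (l 2)) := by
  have h3 : (l 3 : ℝ) = -l 0 - l 1 - l 2 := by
    have : l 3 = -l 0 - l 1 - l 2 := by omega
    rw [this]; push_cast; ring
  rcases le_total (-l 1 - l 2) (l 2) with h | h
  · rw [sum_patternSum 2 (l 0 + 1) 0 (l 1) 0 (by omega)
      (fun a b _ hb => patternWeight_of_nonpos (by omega)) (fun b _ _ => by omega)
      (fun b _ _ a => by omega)]
    simp only [cubicAntidiff]
    push_cast
    ring
  · rw [sum_Ico_int_consecutive _ h (show -l 1 - l 2 ≤ 0 by omega),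
      sum_patternSum 2 (l 0 + 1) 0 (l 1) 0 (show -l 1 - l 2 ≤ 0 by omega)
      (fun a b _ hb => patternWeight_of_nonpos (by omega)) (fun b _ _ => by omega)
      (fun b _ _ a => by omega)]
    rcases le_total (l 1 + l 3) (l 2) with h' | h'
    · rw [sum_patternSum 2 (l 0 + 1) 0 (-l 2) (-1) h
        (fun a b _ hb => patternWeight_of_nonpos (by omega)) (fun b _ _ => by omega)
        (fun b _ _ a => by omega)]
      simp only [cubicAntidiff]
      push_cast
      ring
    · rw [sum_Ico_int_consecutive _ h' (show l 1 + l 3 ≤ -l 1 - l 2 by omega),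
        sum_patternSum_eq_zero fun b _ _ a _ _ => by omega,
        sum_patternSum 2 (l 0 + 1) 0 (-l 2) (-1) (show l 1 + l 3 ≤ -l 1 - l 2 by omega)
        (fun a b _ hb => patternWeight_of_nonpos (by omega)) (fun b _ _ => by omega)
        (fun b _ _ a => by omega)]
      simp only [cubicAntidiff]
      push_cast
      rw [h3]
      ring

lemma patternCount_region₄ (h01 : l 1 ≤ l 0)
    (hsum : l 0 + l 1 + l 2 + l 3 = 0) (h1 : 0 < l 1) (h2 : l 2 < 0) (h03 : l 0 + l 3 ≤ 0) :
    patternCount l = p₄ fun i => (l i : ℝ) := by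
  rw [patternCount, sum_Ico_int_consecutive _ h2.le (show 0 ≤ l 1 + 1 by omega),
    sum_patternSum_region₄_lower h01 hsum h1 h2 h03,
    sum_patternSum_region₄_upper h01 hsum h2 h03]
  have h3 : (l 3 : ℝ) = -l 0 - l 1 - l 2 := by
    have : l 3 = -l 0 - l 1 - l 2 := by omega
    rw [this]; push_cast; ring
  simp only [cubicAntidiff, p₄, h3]
  ring

end Count

end ZeroWeight
end

/-! ### Branching of alternants and the pattern expansion of the character -/

noncomputable section

namespace ZeroWeight

section Branching

variable {R : Type*} [CommRing R]

/-- The homogenized geometric sum `(x ^ a - x ^ b * w ^ (a - b)) / (x - w)`. -/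
def geomSeg (x w : R) (b a : ℕ) : R := ∑ m ∈ Finset.Ico b a, x ^ m * w ^ (a - 1 - m)

lemma geomSeg_mul (x w : R) {b a : ℕ} (h : b ≤ a) :
    geomSeg x w b a * (x - w) = x ^ a - x ^ b * w ^ (a - b) := by
  obtain ⟨k, rfl⟩ := Nat.exists_eq_add_of_le h
  have h1 : geomSeg x w b (b + k) = x ^ b * ∑ i ∈ Finset.range k, x ^ i * w ^ (k - 1 - i) := by
    rw [geomSeg, Finset.sum_Ico_eq_sum_range, Finset.mul_sum, Nat.add_sub_cancel_left]
    refine Finset.sum_congr rfl fun i _ => ?_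
    rw [pow_add, mul_assoc]
    congr 3
    omega
  rw [h1, mul_assoc, geom_sum₂_mul, Nat.add_sub_cancel_left, pow_add]
  ring

/-- The `2 × 2` alternant. -/
def alt₂ (x y : R) (a b : ℕ) : R := x ^ a * y ^ b - x ^ b * y ^ a

/-- The `3 × 3` alternant. -/
def alt₃ (x y z : R) (a b c : ℕ) : R :=
  x ^ a * y ^ b * z ^ c - x ^ a * z ^ b * y ^ c - y ^ a * x ^ b * z ^ c + y ^ a * z ^ b * x ^ c +
    z ^ a * x ^ b * y ^ c - z ^ a * y ^ b * x ^ c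

/-- The `4 × 4` alternant, expanded along the last variable. -/
def alt₄ (x y z w : R) (a b c e : ℕ) : R :=
  alt₃ x y z a b c * w ^ e - alt₃ x y z a b e * w ^ c + alt₃ x y z a c e * w ^ b -
    alt₃ x y z b c e * w ^ a

lemma alt₂_eq (x y : R) {a b : ℕ} (h : b ≤ a) :
    alt₂ x y a b = (x - y) * ∑ j ∈ Finset.Ico b a, x ^ j * y ^ (b + (a - 1 - j)) := by
  have h1 : ∑ j ∈ Finset.Ico b a, x ^ j * y ^ (b + (a - 1 - j)) = y ^ b * geomSeg x y b a := by
    rw [geomSeg, Finset.mul_sum]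
    exact Finset.sum_congr rfl fun j _ => by ring
  have h2 := geomSeg_mul x y h
  have h3 : y ^ a = y ^ b * y ^ (a - b) := by rw [← pow_add, Nat.add_sub_of_le h]
  rw [h1, alt₂, h3]
  linear_combination -y ^ b * h2

lemma sum_mul_sum_mul_sum {ι κ μ : Type*} (s : Finset ι) (t : Finset κ) (u : Finset μ) (f : ι → R)
    (g : κ → R) (h : μ → R) :
    (∑ i ∈ s, f i) * (∑ j ∈ t, g j) * (∑ k ∈ u, h k) =
      ∑ i ∈ s, ∑ j ∈ t, ∑ k ∈ u, f i * g j * h k := by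
  rw [Finset.sum_mul_sum, Finset.sum_mul]
  exact Finset.sum_congr rfl fun i _ => Finset.sum_mul_sum _ _ _ _

lemma alt₃_eq (x y z : R) {a b c : ℕ} (hab : b ≤ a) (hbc : c ≤ b) :
    alt₃ x y z a b c = (x - z) * (y - z) * ∑ i ∈ Finset.Ico b a, ∑ j ∈ Finset.Ico c b,
      alt₂ x y i j * z ^ ((a - 1 - i) + (b - 1 - j) + c) := by
  have h1 : ∑ i ∈ Finset.Ico b a, ∑ j ∈ Finset.Ico c b,
      alt₂ x y i j * z ^ ((a - 1 - i) + (b - 1 - j) + c) =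
      z ^ c * (geomSeg x z b a * geomSeg y z c b - geomSeg y z b a * geomSeg x z c b) := by
    simp only [geomSeg, Finset.sum_mul_sum]
    simp only [← Finset.sum_sub_distrib, Finset.mul_sum]
    refine Finset.sum_congr rfl fun i _ => Finset.sum_congr rfl fun j _ => ?_
    rw [alt₂]
    ring
  have e1 := geomSeg_mul x z hab
  have e2 := geomSeg_mul y z hab
  have e3 := geomSeg_mul x z hbc
  have e4 := geomSeg_mul y z hbc
  have f1 : z ^ b = z ^ c * z ^ (b - c) := by rw [← pow_add, Nat.add_sub_of_le hbc]
  have f2 : z ^ a = z ^ c * z ^ (b - c) * z ^ (a - b) := by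
    rw [← f1, ← pow_add, Nat.add_sub_of_le hab]
  have h2 : (x - z) * (y - z) * (z ^ c * (geomSeg x z b a * geomSeg y z c b -
      geomSeg y z b a * geomSeg x z c b)) = z ^ c *
      ((geomSeg x z b a * (x - z)) * (geomSeg y z c b * (y - z)) -
        (geomSeg y z b a * (y - z)) * (geomSeg x z c b * (x - z))) := by ring
  rw [h1, h2, e1, e2, e3, e4, alt₃, f2, f1]
  ring

/-- Subtracting from each column of the alternant a power of `w` times the next one clears the row
of `w` and leaves a `3 × 3` determinant of differences `x ^ a - x ^ b * w ^ (a - b)`. Each row has a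
factor `x - w`, and the quotients are geometric sums; multilinearity gives the interlacing sum.
`alt₃_eq` is the same argument one size down. -/
lemma alt₄_eq (x y z w : R) {a b c e : ℕ} (hab : b ≤ a) (hbc : c ≤ b) (hce : e ≤ c) :
    alt₄ x y z w a b c e = (x - w) * (y - w) * (z - w) *
      ∑ i ∈ Finset.Ico b a, ∑ j ∈ Finset.Ico c b, ∑ k ∈ Finset.Ico e c,
        alt₃ x y z i j k * w ^ ((a - 1 - i) + (b - 1 - j) + (c - 1 - k) + e) := by
  have h1 : ∑ i ∈ Finset.Ico b a, ∑ j ∈ Finset.Ico c b, ∑ k ∈ Finset.Ico e c,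
        alt₃ x y z i j k * w ^ ((a - 1 - i) + (b - 1 - j) + (c - 1 - k) + e) =
      w ^ e * (geomSeg x w b a * geomSeg y w c b * geomSeg z w e c -
        geomSeg x w b a * geomSeg z w c b * geomSeg y w e c -
        geomSeg y w b a * geomSeg x w c b * geomSeg z w e c +
        geomSeg y w b a * geomSeg z w c b * geomSeg x w e c +
        geomSeg z w b a * geomSeg x w c b * geomSeg y w e c -
        geomSeg z w b a * geomSeg y w c b * geomSeg x w e c) := by
    simp only [geomSeg, sum_mul_sum_mul_sum]
    simp only [← Finset.sum_sub_distrib, ← Finset.sum_add_distrib, Finset.mul_sum]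
    refine Finset.sum_congr rfl fun i _ => Finset.sum_congr rfl fun j _ =>
      Finset.sum_congr rfl fun k _ => ?_
    rw [alt₃]
    ring
  have a1 := geomSeg_mul x w hab
  have a2 := geomSeg_mul y w hab
  have a3 := geomSeg_mul z w hab
  have b1 := geomSeg_mul x w hbc
  have b2 := geomSeg_mul y w hbc
  have b3 := geomSeg_mul z w hbc
  have c1 := geomSeg_mul x w hce
  have c2 := geomSeg_mul y w hce
  have c3 := geomSeg_mul z w hce
  have f0 : w ^ c = w ^ e * w ^ (c - e) := by rw [← pow_add, Nat.add_sub_of_le hce]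
  have f1 : w ^ b = w ^ e * w ^ (c - e) * w ^ (b - c) := by
    rw [← f0, ← pow_add, Nat.add_sub_of_le hbc]
  have f2 : w ^ a = w ^ e * w ^ (c - e) * w ^ (b - c) * w ^ (a - b) := by
    rw [← f1, ← pow_add, Nat.add_sub_of_le hab]
  have h2 : ∀ g1 g2 g3 k1 k2 k3 m1 m2 m3 : R, (x - w) * (y - w) * (z - w) * (w ^ e *
      (g1 * k2 * m3 - g1 * k3 * m2 - g2 * k1 * m3 + g2 * k3 * m1 + g3 * k1 * m2 - g3 * k2 * m1)) =
      w ^ e * ((g1 * (x - w)) * (k2 * (y - w)) * (m3 * (z - w)) -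
        (g1 * (x - w)) * (k3 * (z - w)) * (m2 * (y - w)) -
        (g2 * (y - w)) * (k1 * (x - w)) * (m3 * (z - w)) +
        (g2 * (y - w)) * (k3 * (z - w)) * (m1 * (x - w)) +
        (g3 * (z - w)) * (k1 * (x - w)) * (m2 * (y - w)) -
        (g3 * (z - w)) * (k2 * (y - w)) * (m1 * (x - w))) := by intros; ring
  rw [h1, h2, a1, a2, a3, b1, b2, b3, c1, c2, c3, alt₄, alt₃, alt₃, alt₃, alt₃, f2, f1, f0]
  ring

end Branching

/-- The Schur polynomial in four variables as a sum over Gelfand–Tsetlin patterns, where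
`L` is the top row shifted by `(3, 2, 1, 0)`. -/
def patternPoly (L : Fin 4 → ℕ) : MvPolynomial (Fin 4) ℂ :=
  ∑ a ∈ Finset.Ico (L 1) (L 0), ∑ b ∈ Finset.Ico (L 2) (L 1), ∑ c ∈ Finset.Ico (L 3) (L 2),
    ∑ i ∈ Finset.Ico b a, ∑ j ∈ Finset.Ico c b, ∑ k ∈ Finset.Ico j i,
      MvPolynomial.monomial (Finsupp.equivFunOnFinite.symm ![k, j + (i - 1 - k),
        (a - 1 - i) + (b - 1 - j) + c, (L 0 - 1 - a) + (L 1 - 1 - b) + (L 2 - 1 - c) + L 3]) 1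

lemma monomial_four (a b c e : ℕ) :
    (MvPolynomial.monomial (Finsupp.equivFunOnFinite.symm ![a, b, c, e]) 1 :
      MvPolynomial (Fin 4) ℂ) =
    MvPolynomial.X 0 ^ a * MvPolynomial.X 1 ^ b * MvPolynomial.X 2 ^ c * MvPolynomial.X 3 ^ e := by
  rw [MvPolynomial.monomial_eq, Finsupp.prod_fintype _ _ fun _ => pow_zero _, Fin.prod_univ_four]
  simp

lemma altPoly_four (L : Fin 4 → ℕ) : altPoly L = alt₄ (MvPolynomial.X 0) (MvPolynomial.X 1)
    (MvPolynomial.X 2) (MvPolynomial.X 3) (L 0) (L 1) (L 2) (L 3) := by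
  rw [altPoly, Matrix.det_succ_row_zero, alt₄, alt₃, alt₃, alt₃, alt₃]
  simp [Fin.sum_univ_succ, Matrix.det_fin_three, Fin.succAbove]
  ring

/-- Branch from four variables to three, to two and to one, each step splitting off the Vandermonde
factors that contain the last variable. The shifts of the rows turn the interlacing conditions into
half-open intervals. -/
lemma vandermondeFour_mul_patternPoly {L : Fin 4 → ℕ} (hL : StrictAnti L) :
    vandermondeFour * patternPoly L = altPoly L := by
  have h1 : L 1 ≤ L 0 := (hL (by decide)).le
  have h2 : L 2 ≤ L 1 := (hL (by decide)).le
  have h3 : L 3 ≤ L 2 := (hL (by decide)).le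
  rw [altPoly_four, alt₄_eq _ _ _ _ h1 h2 h3]
  have key : ∀ a b c, b ≤ a → c ≤ b → alt₃ (MvPolynomial.X 0 : MvPolynomial (Fin 4) ℂ)
      (MvPolynomial.X 1) (MvPolynomial.X 2) a b c =
      (MvPolynomial.X 0 - MvPolynomial.X 2) * (MvPolynomial.X 1 - MvPolynomial.X 2) *
        ((MvPolynomial.X 0 - MvPolynomial.X 1) * ∑ i ∈ Finset.Ico b a, ∑ j ∈ Finset.Ico c b,
          ∑ k ∈ Finset.Ico j i, MvPolynomial.X 0 ^ k * MvPolynomial.X 1 ^ (j + (i - 1 - k)) *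
            MvPolynomial.X 2 ^ ((a - 1 - i) + (b - 1 - j) + c)) := by
    intro a b c hab hbc
    rw [alt₃_eq _ _ _ hab hbc]
    simp only [Finset.mul_sum (s := Finset.Ico b a)]
    refine Finset.sum_congr rfl fun i hi => ?_
    simp only [Finset.mul_sum (s := Finset.Ico c b)]
    refine Finset.sum_congr rfl fun j hj => ?_
    rw [Finset.mem_Ico] at hi hj
    rw [alt₂_eq _ _ (show j ≤ i by omega), ← Finset.sum_mul]
    ring
  have hV : (vandermondeFour : MvPolynomial (Fin 4) ℂ) =
      (MvPolynomial.X 0 - MvPolynomial.X 3) * (MvPolynomial.X 1 - MvPolynomial.X 3) *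
      (MvPolynomial.X 2 - MvPolynomial.X 3) * ((MvPolynomial.X 0 - MvPolynomial.X 2) *
        (MvPolynomial.X 1 - MvPolynomial.X 2) * (MvPolynomial.X 0 - MvPolynomial.X 1)) := by
    rw [vandermondeFour]; ring
  rw [hV, mul_assoc]
  congr 1
  rw [patternPoly, Finset.mul_sum]
  refine Finset.sum_congr rfl fun a ha => ?_
  rw [Finset.mul_sum]
  refine Finset.sum_congr rfl fun b hb => ?_
  rw [Finset.mul_sum]
  refine Finset.sum_congr rfl fun c hc => ?_
  rw [Finset.mem_Ico] at ha hb hc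
  rw [key a b c (by omega) (by omega)]
  simp only [monomial_four, ← Finset.sum_mul]
  ring

lemma vandermondeFour_ne_zero : vandermondeFour ≠ 0 := by
  intro h
  have h1 := coeff_altPoly_self (L := ![3, 2, 1, 0]) (by decide)
  rw [← vandermondeFour_eq_altPoly, h] at h1
  simp at h1

lemma sum_Ico_ite_eq_add {b c n t : ℕ} (x : ℂ) :
    ∑ j ∈ Finset.Ico c b, (if n + j = t then x else 0) =
      if n + c ≤ t ∧ t < n + b then x else 0 := by
  split_ifs with h
  · rw [Finset.sum_eq_single (t - n)]
    · rw [if_pos (by omega)]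
    · intro j _ hj
      rw [if_neg (by omega)]
    · intro hj
      rw [Finset.mem_Ico] at hj
      omega
  · refine Finset.sum_eq_zero fun j hj => if_neg ?_
    rw [Finset.mem_Ico] at hj
    omega

/-- The coefficient of `(X₀ X₁ X₂ X₃) ^ N`, as a sum over the third row of the patterns. -/
lemma coeff_patternPoly {L : Fin 4 → ℕ} {N : ℕ} (hsum : L 0 + L 1 + L 2 + L 3 = 4 * N + 6) :
    MvPolynomial.coeff (Finsupp.equivFunOnFinite.symm fun _ => N) (patternPoly L) =
    ∑ a ∈ Finset.Ico (L 1) (L 0), ∑ b ∈ Finset.Ico (L 2) (L 1), ∑ c ∈ Finset.Ico (L 3) (L 2),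
      if a + b + c = 3 * N + 3 then
        (patternWeight ((a : ℤ) - N - 2) ((b : ℤ) - N - 1) : ℂ) else 0 := by
  simp only [patternPoly, MvPolynomial.coeff_sum, MvPolynomial.coeff_monomial]
  refine Finset.sum_congr rfl fun a ha => Finset.sum_congr rfl fun b hb =>
    Finset.sum_congr rfl fun c hc => ?_
  rw [Finset.mem_Ico] at ha hb hc
  have h1 : ∀ i ∈ Finset.Ico b a, ∀ j ∈ Finset.Ico c b, (∑ k ∈ Finset.Ico j i,
      if Finsupp.equivFunOnFinite.symm ![k, j + (i - 1 - k), (a - 1 - i) + (b - 1 - j) + c,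
        (L 0 - 1 - a) + (L 1 - 1 - b) + (L 2 - 1 - c) + L 3] =
        (Finsupp.equivFunOnFinite.symm fun _ : Fin 4 => N) then (1 : ℂ) else 0) =
      if a + b + c = 3 * N + 3 then if i + j = 2 * N + 1 then 1 else 0 else 0 := by
    intro i hi j hj
    rw [Finset.mem_Ico] at hi hj
    -- The exponents are differences of consecutive row sums, so equal exponents `N` fix the shifted
    -- row sums at `N`, `2N + 1`, `3N + 3`; the last exponent is then right by `hsum`.
    have h2 : ∀ k ∈ Finset.Ico j i, (Finsupp.equivFunOnFinite.symm ![k, j + (i - 1 - k),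
        (a - 1 - i) + (b - 1 - j) + c,
        (L 0 - 1 - a) + (L 1 - 1 - b) + (L 2 - 1 - c) + L 3] =
        (Finsupp.equivFunOnFinite.symm fun _ : Fin 4 => N)) ↔
        (k = N ∧ i + j = 2 * N + 1 ∧ a + b + c = 3 * N + 3) := by
      intro k hk
      rw [Finset.mem_Ico] at hk
      rw [Equiv.apply_eq_iff_eq, funext_iff, Fin.forall_fin_succ, Fin.forall_fin_succ,
        Fin.forall_fin_succ, Fin.forall_fin_succ]
      simp only [Matrix.cons_val_zero, Matrix.cons_val_succ, IsEmpty.forall_iff, and_true]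
      omega
    rw [Finset.sum_congr rfl fun k hk => if_congr (h2 k hk) rfl rfl]
    by_cases h3 : a + b + c = 3 * N + 3
    · by_cases h4 : i + j = 2 * N + 1
      · simp only [h3, h4, and_true, if_true]
        rw [Finset.sum_ite_eq', if_pos]
        rw [Finset.mem_Ico]
        omega
      · simp [h4]
    · simp [h3]
  rw [Finset.sum_congr rfl fun i hi => Finset.sum_congr rfl fun j hj => h1 i hi j hj]
  by_cases h3 : a + b + c = 3 * N + 3
  · simp only [h3, if_true, sum_Ico_ite_eq_add]
    rw [Finset.sum_boole]
    -- The condition is that `j = 2 * N + 1 - i` lies in `[c, b)`. Undoing the shift `(2, 1, 0)` of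
    -- the third row and subtracting `N` turns the length of this interval into `patternWeight`.
    have h4 : Finset.filter (fun i => i + c ≤ 2 * N + 1 ∧ 2 * N + 1 < i + b) (Finset.Ico b a) =
        Finset.Ico (max b (2 * N + 2 - b)) (min a (2 * N + 2 - c)) := by
      ext i
      rw [Finset.mem_filter, Finset.mem_Ico, Finset.mem_Ico]
      omega
    rw [h4, Nat.card_Ico]
    have h5 : ((min a (2 * N + 2 - c) - max b (2 * N + 2 - b) : ℕ) : ℤ) =
        patternWeight ((a : ℤ) - N - 2) ((b : ℤ) - N - 1) := by
      rw [patternWeight]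
      split_ifs <;> omega
    exact_mod_cast congrArg (Int.cast : ℤ → ℂ) h5
  · simp [h3]

lemma sum_Ico_nat_shift (f : ℤ → ℂ) (p q : ℕ) (s : ℤ) :
    ∑ m ∈ Finset.Ico p q, f ((m : ℤ) - s) = ∑ x ∈ Finset.Ico ((p : ℤ) - s) (q - s), f x := by
  refine Finset.sum_bij' (fun m _ => (m : ℤ) - s) (fun x _ => (x + s).toNat) ?_ ?_ ?_ ?_ ?_
  · intro m hm
    rw [Finset.mem_Ico] at *
    omega
  · intro x hx
    rw [Finset.mem_Ico] at *
    omega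
  · intro m _
    simp
  · intro x hx
    rw [Finset.mem_Ico] at hx
    omega
  · intro m _
    rfl

lemma coeff_patternPoly_eq_patternCount {L : Fin 4 → ℕ} {N : ℕ} {l : Fin 4 → ℤ}
    (hsum : L 0 + L 1 + L 2 + L 3 = 4 * N + 6) (h0 : l 0 = L 0 - N - 3) (h1 : l 1 = L 1 - N - 2)
    (h2 : l 2 = L 2 - N - 1) (h3 : l 3 = L 3 - N) :
    MvPolynomial.coeff (Finsupp.equivFunOnFinite.symm fun _ => N) (patternPoly L) =
      (patternCount l : ℂ) := by
  rw [coeff_patternPoly hsum, patternCount, Finset.sum_comm]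
  simp only [patternSum, h0, h1, h2, h3]
  push_cast
  have key : ∀ b : ℕ, (∑ a ∈ Finset.Ico (L 1) (L 0), ∑ c ∈ Finset.Ico (L 3) (L 2),
      if a + b + c = 3 * N + 3 then
        (patternWeight ((a : ℤ) - N - 2) ((b : ℤ) - N - 1) : ℂ) else 0) =
      ∑ a ∈ Finset.Ico ((L 1 : ℤ) - (N + 2)) (L 0 - (N + 2)),
        if (L 3 : ℤ) - N ≤ -a - (b - (N + 1)) ∧ -a - ((b : ℤ) - (N + 1)) ≤ L 2 - N - 1 then
          (patternWeight a ((b : ℤ) - (N + 1)) : ℂ) else 0 := by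
    intro b
    rw [← sum_Ico_nat_shift (fun a => if (L 3 : ℤ) - N ≤ -a - (b - (N + 1)) ∧
      -a - ((b : ℤ) - (N + 1)) ≤ L 2 - N - 1 then
          (patternWeight a ((b : ℤ) - (N + 1)) : ℂ) else 0)]
    refine Finset.sum_congr rfl fun a _ => ?_
    rw [sum_Ico_ite_eq_add, sub_sub, sub_sub]
    refine if_congr ?_ rfl rfl
    omega
  simp only [key]
  rw [sum_Ico_nat_shift (fun b => ∑ a ∈ Finset.Ico ((L 1 : ℤ) - (N + 2)) (L 0 - (N + 2)),
        if (L 3 : ℤ) - N ≤ -a - b ∧ -a - b ≤ L 2 - N - 1 then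
          (patternWeight a b : ℂ) else 0)]
  have e1 : (L 2 : ℤ) - (N + 1) = L 2 - N - 1 := by ring
  have e2 : (L 1 : ℤ) - (N + 1) = L 1 - N - 2 + 1 := by ring
  have e3 : (L 1 : ℤ) - (N + 2) = L 1 - N - 2 := by ring
  have e4 : (L 0 : ℤ) - (N + 2) = L 0 - N - 3 + 1 := by ring
  rw [e1, e2, e3, e4]
  refine Finset.sum_congr rfl fun b _ => Finset.sum_congr rfl fun a _ => ?_
  split_ifs <;> simp

end ZeroWeight
end

/-! ### Regular functions on `GL_n` -/

noncomputable section

namespace ZeroWeight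

section Regular

variable {n : ℕ}

lemma IsRegularFun.const (c : ℂ) : IsRegularFun fun _ : GL (Fin n) ℂ => c :=
  ⟨0, MvPolynomial.C c, fun g => by simp⟩

lemma GL_det_ne_zero (g : GL (Fin n) ℂ) : (g : Matrix (Fin n) (Fin n) ℂ).det ≠ 0 :=
  (Matrix.isUnits_det_units g).ne_zero

/-- The determinant as a polynomial in the matrix entries. -/
def detPoly (n : ℕ) : MvPolynomial (Fin n × Fin n) ℂ :=
  (Matrix.of fun i j => MvPolynomial.X (i, j) : Matrix (Fin n) (Fin n) _).det

lemma eval_detPoly (A : Matrix (Fin n) (Fin n) ℂ) :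
    MvPolynomial.eval (fun ij => A ij.1 ij.2) (detPoly n) = A.det := by
  rw [detPoly, RingHom.map_det]
  congr 1
  ext i j
  simp

lemma eval_adjugatePoly (A : Matrix (Fin n) (Fin n) ℂ) (i j : Fin n) :
    MvPolynomial.eval (fun ij => A ij.1 ij.2)
      ((Matrix.of fun i j => MvPolynomial.X (i, j) : Matrix (Fin n) (Fin n) _).adjugate i j) =
      A.adjugate i j := by
  have h := RingHom.map_adjugate (MvPolynomial.eval fun ij : Fin n × Fin n => A ij.1 ij.2)
    (Matrix.of fun i j => MvPolynomial.X (i, j) : Matrix (Fin n) (Fin n) _)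
  have h2 := congrFun (congrFun h i) j
  rw [RingHom.mapMatrix_apply, Matrix.map_apply] at h2
  rw [h2]
  congr 1
  ext i j
  simp

lemma IsRegularFun.mul {f g : GL (Fin n) ℂ → ℂ} (hf : IsRegularFun f) (hg : IsRegularFun g) :
    IsRegularFun fun x => f x * g x := by
  obtain ⟨N, P, hP⟩ := hf
  obtain ⟨M, Q, hQ⟩ := hg
  refine ⟨N + M, P * Q, fun x => ?_⟩
  change f x * g x = _
  rw [hP, hQ, map_mul]
  ring

lemma IsRegularFun.add {f g : GL (Fin n) ℂ → ℂ} (hf : IsRegularFun f) (hg : IsRegularFun g) :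
    IsRegularFun fun x => f x + g x := by
  obtain ⟨N, P, hP⟩ := hf
  obtain ⟨M, Q, hQ⟩ := hg
  refine ⟨N + M, detPoly n ^ M * P + detPoly n ^ N * Q, fun x => ?_⟩
  change f x + g x = _
  rw [hP, hQ, map_add, map_mul, map_mul, map_pow, map_pow, eval_detPoly]
  have h1 : ∀ k : ℕ, ((x : Matrix (Fin n) (Fin n) ℂ).det)⁻¹ ^ k *
      (x : Matrix (Fin n) (Fin n) ℂ).det ^ k = 1 := fun k => by
    rw [← mul_pow, inv_mul_cancel₀ (GL_det_ne_zero x), one_pow]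
  rw [pow_add, mul_add]
  linear_combination (-((x : Matrix (Fin n) (Fin n) ℂ).det)⁻¹ ^ N *
    MvPolynomial.eval (fun ij => (x : Matrix (Fin n) (Fin n) ℂ) ij.1 ij.2) P) * h1 M -
    ((x : Matrix (Fin n) (Fin n) ℂ).det)⁻¹ ^ M *
    MvPolynomial.eval (fun ij => (x : Matrix (Fin n) (Fin n) ℂ) ij.1 ij.2) Q * h1 N

/-- The entries of `x⁻¹` are adjugate entries divided by the determinant, and the factor `det⁻¹`
becomes `det`, itself a polynomial. -/
lemma IsRegularFun.comp_inv {f : GL (Fin n) ℂ → ℂ} (hf : IsRegularFun f) :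
    IsRegularFun fun x => f x⁻¹ := by
  obtain ⟨N, P, hP⟩ := hf
  have h1 : IsRegularFun fun x : GL (Fin n) ℂ => MvPolynomial.eval
      (fun ij => ((x⁻¹ : GL (Fin n) ℂ) : Matrix (Fin n) (Fin n) ℂ) ij.1 ij.2) P := by
    induction P using MvPolynomial.induction_on generalizing f with
    | C a => simpa using IsRegularFun.const a
    | add p q hp hq =>
      simp only [map_add]
      exact (hp fun _ => rfl).add (hq fun _ => rfl)
    | mul_X p i hp =>
      simp only [map_mul, MvPolynomial.eval_X]
      refine (hp fun _ => rfl).mul ⟨1, (Matrix.of fun i j => MvPolynomial.X (i, j) :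
        Matrix (Fin n) (Fin n) _).adjugate i.1 i.2, fun x => ?_⟩
      change ((x⁻¹ : GL (Fin n) ℂ) : Matrix (Fin n) (Fin n) ℂ) i.1 i.2 = _
      rw [eval_adjugatePoly, pow_one, Matrix.coe_units_inv, Matrix.inv_def, Matrix.smul_apply,
        Ring.inverse_eq_inv', smul_eq_mul]
  have h2 : IsRegularFun fun x : GL (Fin n) ℂ => (x : Matrix (Fin n) (Fin n) ℂ).det ^ N :=
    ⟨0, detPoly n ^ N, fun x => by rw [map_pow, eval_detPoly, pow_zero, one_mul]⟩
  have h3 : (fun x => f x⁻¹) = fun x : GL (Fin n) ℂ => (x : Matrix (Fin n) (Fin n) ℂ).det ^ N *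
      MvPolynomial.eval
      (fun ij => ((x⁻¹ : GL (Fin n) ℂ) : Matrix (Fin n) (Fin n) ℂ) ij.1 ij.2) P := by
    funext x
    rw [hP, Matrix.coe_units_inv, Matrix.det_nonsing_inv, Ring.inverse_eq_inv', inv_inv]
  rw [h3]
  exact h2.mul h1

end Regular

/-! ### Lower triangular matrices and the highest weight projection -/

section Lowest

variable {d : ℕ} {P : Matrix (Fin d) (Fin d) (MvPolynomial (Fin 4 × Fin 4) ℂ)} {v : Fin d → ℂ}

/-- The projection to the highest weight space is an eigenvector for lower triangular matrices. -/
lemma IsHighestVec.weightMat_mul_polyMap (h : IsPolyRep P) (hirr : IsIrreduciblePoly P)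
    {m : Fin 4 →₀ ℕ} (hv : IsHighestVec P (fun i => (m i : ℤ)) v)
    {g : Matrix (Fin 4) (Fin 4) ℂ} (hg : ∀ i j, i < j → g i j = 0) (hdet : g.det ≠ 0) :
    weightMat P m * polyMap P g = (∏ i, g i i ^ m i) • weightMat P m := by
  -- For `s ≠ 0` this is the conjugate of `g` by `diag(1, s, s², s³)`, and at `s = 0` it degenerates
  -- to the diagonal of `g`. The truncated subtraction does no harm, as `g` vanishes above the
  -- diagonal.
  set G : ℂ → Matrix (Fin 4) (Fin 4) ℂ := fun s => Matrix.of fun i j => g i j * s ^ (i.val - j.val)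
    with hG
  have hcont : ∀ (A B : Matrix (Fin d) (Fin d) ℂ) (a b : Fin d),
      Continuous fun s => (A * polyMap P (G s) * B) a b := by
    intro A B a b
    simp only [Matrix.mul_apply]
    refine continuous_finsetSum _ fun c _ => Continuous.mul
      (continuous_finsetSum _ fun e _ => continuous_const.mul ?_) continuous_const
    refine (MvPolynomial.continuous_eval (P e c)).comp (continuous_pi fun ij => ?_)
    exact continuous_const.mul (continuous_pow _)
  have hgdiag : ∀ i, g i i ≠ 0 := by
    rw [Matrix.det_of_isLowerTriangular g fun i j hij => hg i j hij] at hdet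
    exact fun i => Finset.prod_ne_zero_iff.mp hdet i (Finset.mem_univ i)
  have hG0 : G 0 = diagonal fun i => g i i := by
    ext i j
    rcases lt_trichotomy i j with hij | rfl | hij
    · simp [hG, hg i j hij, hij.ne]
    · simp [hG]
    · have : i.val - j.val ≠ 0 := by have := Fin.lt_def.mp hij; omega
      simp [hG, hij.ne', this]
  have hGdet : ∀ s, (G s).det ≠ 0 := by
    intro s
    rw [Matrix.det_of_isLowerTriangular (G s) fun i j hij => by simp [hG, hg i j hij]]
    refine Finset.prod_ne_zero_iff.mpr fun i _ => ?_
    simp [hG, hgdiag i]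
  have hpow : ∀ (s : ℂ) (r : Fin 4 →₀ ℕ),
      ∏ i : Fin 4, (s ^ i.val) ^ r i = s ^ (r 1 + 2 * r 2 + 3 * r 3) := by
    intro s r
    rw [Fin.prod_univ_four]
    simp only [← pow_mul, ← pow_add]
    congr 1
    simp
  have hconj : ∀ s : ℂ, s ≠ 0 → ∀ r : Fin 4 →₀ ℕ,
      s ^ (r 1 + 2 * r 2 + 3 * r 3) • (weightMat P m * polyMap P (G s) * weightMat P r) =
        s ^ (m 1 + 2 * m 2 + 3 * m 3) • (weightMat P m * polyMap P g * weightMat P r) := by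
    intro s hs r
    have hD : ∀ i : Fin 4, s ^ i.val ≠ 0 := fun i => pow_ne_zero _ hs
    have h1 : G s * diagonal (fun i : Fin 4 => s ^ i.val) =
        diagonal (fun i : Fin 4 => s ^ i.val) * g := by
      ext i j
      rw [Matrix.mul_diagonal, Matrix.diagonal_mul]
      simp only [hG, Matrix.of_apply]
      rcases lt_or_ge i j with hij | hij
      · simp [hg i j hij]
      · rw [mul_assoc, ← pow_add, Nat.sub_add_cancel (Fin.le_def.mp hij), mul_comm]
    have h2 := congrArg (polyMap P) h1
    rw [h.map_mul _ _ (hGdet s) (det_diagonal_ne_zero hD),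
      h.map_mul _ _ (det_diagonal_ne_zero hD) hdet] at h2
    have h3 := congrArg (fun M => weightMat P m * M * weightMat P r) h2
    simp only [mul_assoc, h.polyMap_diagonal_mul_weightMat hD] at h3
    rw [← mul_assoc (weightMat P m) (polyMap P (diagonal _)),
      h.weightMat_mul_polyMap_diagonal hD] at h3
    simp only [hpow, Matrix.mul_smul, Matrix.smul_mul] at h3
    rw [mul_assoc, mul_assoc]
    exact h3
  have hr : ∀ r : Fin 4 →₀ ℕ, weightMat P m * polyMap P g * weightMat P r =
      if r = m then (∏ i, g i i ^ m i) • weightMat P m else 0 := by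
    intro r
    -- Cancel the common power of `s` and extend to `s = 0` by continuity. A weight `r ≠ m` below
    -- `m` has `k > 0`, so its block vanishes; for `r = m` the diagonal of `g` remains.
    have hlim : ∀ k : ℕ, r 1 + 2 * r 2 + 3 * r 3 = m 1 + 2 * m 2 + 3 * m 3 + k →
        weightMat P m * polyMap P g * weightMat P r =
          (0 : ℂ) ^ k • (weightMat P m * polyMap P (G 0) * weightMat P r) := by
      intro k hk
      ext a b
      have h1 := Continuous.ext_on (dense_compl_singleton (0 : ℂ))
        (continuous_const (y := (weightMat P m * polyMap P g * weightMat P r) a b))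
        ((continuous_pow k).mul (hcont (weightMat P m) (weightMat P r) a b)) (fun s hs => by
          have h2 := hconj s hs r
          rw [hk, pow_add, ← smul_smul] at h2
          have h3 := smul_right_injective _ (pow_ne_zero _ hs) h2
          exact (congrFun (congrFun h3 a) b).symm)
      exact congrFun h1 0
    by_cases hrm : r = m
    · subst hrm
      have hproj : weightMat P r * weightMat P r = weightMat P r := by
        refine hv.matrix_ext h hirr fun μ w _ => ?_
        rw [← mulVec_mulVec, h.weightMat_mulVec_of_eq (h.isWeightVec_weightMat r w)]
      rw [if_pos rfl, hlim 0 (by omega), pow_zero, one_smul, hG0,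
        h.weightMat_mul_polyMap_diagonal hgdiag, Matrix.smul_mul, hproj]
    · rw [if_neg hrm]
      by_cases hz : weightMat P r = 0
      · rw [hz, mul_zero]
      · obtain ⟨h1, h2, h3, h4⟩ := hv.dominated_of_weightMat_ne_zero h hirr hz
        simp only at h1 h2 h3 h4
        have h5 : m 1 + 2 * m 2 + 3 * m 3 < r 1 + 2 * r 2 + 3 * r 3 := by
          by_contra hcon
          refine hrm (Finsupp.ext fun i => ?_)
          fin_cases i <;> simp <;> omega
        obtain ⟨k, hk⟩ := Nat.exists_eq_add_of_lt h5
        rw [hlim (k + 1) (by omega), pow_succ, mul_zero, zero_smul]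
  have hfin : weightMat P m * polyMap P g =
      ∑ r ∈ weightSupp P, weightMat P m * polyMap P g * weightMat P r := by
    rw [← Finset.mul_sum, h.sum_weightMat, mul_one]
  rw [hfin, Finset.sum_congr rfl fun r _ => hr r, Finset.sum_ite_eq']
  split_ifs with hm
  · rfl
  · rw [weightMat_eq_zero hm, smul_zero]

end Lowest

end ZeroWeight
end

/-! ### From rational to polynomial representations -/

noncomputable section

namespace ZeroWeight

section Linearize

variable {n : ℕ} {V : Type*} [AddCommGroup V] [Module ℂ V] [FiniteDimensional ℂ V]
  {ρ : Representation ℂ (GL (Fin n) ℂ) V}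

/-- The matrix-valued polynomial `P` is the twist of `ρ` by the `N`-th power of the determinant. -/
def IsTwist (ρ : Representation ℂ (GL (Fin n) ℂ) V) (N : ℕ)
    (P : Matrix (Fin (Module.finrank ℂ V)) (Fin (Module.finrank ℂ V))
      (MvPolynomial (Fin n × Fin n) ℂ)) : Prop :=
  ∀ (g : GL (Fin n) ℂ) (x : V), polyMap P g *ᵥ (Module.finBasis ℂ V).equivFun x =
    (g : Matrix (Fin n) (Fin n) ℂ).det ^ N • (Module.finBasis ℂ V).equivFun (ρ g x)

/-- Each of the finitely many matrix entries has its own denominator `det ^ M a c`; the sum of these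
exponents is a common bound. -/
lemma IsRational.exists_isTwist (hρ : IsRational ρ) : ∃ N P, IsTwist ρ N P := by
  have h := fun a c : Fin (Module.finrank ℂ V) =>
    hρ (Module.finBasis ℂ V c) ((Module.finBasis ℂ V).coord a)
  choose M Q hQ using h
  refine ⟨∑ a, ∑ c, M a c, Matrix.of fun a c => detPoly n ^ (∑ a, ∑ c, M a c - M a c) * Q a c,
    fun g x => ?_⟩
  have hM : ∀ a c, M a c ≤ ∑ a, ∑ c, M a c := fun a c =>
    (Finset.single_le_sum (f := fun c => M a c) (fun _ _ => Nat.zero_le _)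
      (Finset.mem_univ c)).trans (Finset.single_le_sum (f := fun a => ∑ c, M a c)
        (fun _ _ => Nat.zero_le _) (Finset.mem_univ a))
  generalize (∑ a, ∑ c, M a c) = N at hM
  have hmat : polyMap (Matrix.of fun a c => detPoly n ^ (N - M a c) * Q a c)
      (g : Matrix (Fin n) (Fin n) ℂ) = (g : Matrix (Fin n) (Fin n) ℂ).det ^ N •
        LinearMap.toMatrix (Module.finBasis ℂ V) (Module.finBasis ℂ V) (ρ g) := by
    ext a c
    have h1 : (Module.finBasis ℂ V).repr (ρ g (Module.finBasis ℂ V c)) a = _ := hQ a c g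
    rw [Matrix.smul_apply, LinearMap.toMatrix_apply, h1]
    change MvPolynomial.eval _ (detPoly n ^ (N - M a c) * Q a c) = _
    rw [map_mul, map_pow, eval_detPoly, smul_eq_mul, ← mul_assoc, inv_pow]
    congr 1
    rw [← div_eq_mul_inv, eq_div_iff (pow_ne_zero _ (GL_det_ne_zero g)), ← pow_add,
      Nat.sub_add_cancel (hM a c)]
  rw [hmat, smul_mulVec]
  congr 1
  exact LinearMap.toMatrix_mulVec_repr _ _ _ _

/-- An invertible matrix as an element of `GL_n(ℂ)`. -/
lemma exists_GL_eq {A : Matrix (Fin n) (Fin n) ℂ} (hA : A.det ≠ 0) :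
    ∃ g : GL (Fin n) ℂ, (g : Matrix (Fin n) (Fin n) ℂ) = A :=
  ⟨Matrix.GeneralLinearGroup.mkOfDetNeZero A hA, rfl⟩

lemma eq_bot_or_eq_top_of_irreducible {G W : Type*} [Group G] [AddCommGroup W] [Module ℂ W]
    {σ : Representation ℂ G W} (hσ : σ.IsIrreducible) (U : Submodule ℂ W)
    (hU : ∀ g, ∀ w ∈ U, σ g w ∈ U) : U = ⊥ ∨ U = ⊤ := by
  rcases hσ.eq_bot_or_eq_top ⟨U, fun g w hw => hU g w hw⟩ with h | h
  · exact Or.inl (congrArg Subrepresentation.toSubmodule h)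
  · exact Or.inr (congrArg Subrepresentation.toSubmodule h)

variable {N : ℕ} {P : Matrix (Fin (Module.finrank ℂ V)) (Fin (Module.finrank ℂ V))
      (MvPolynomial (Fin n × Fin n) ℂ)}

namespace IsTwist

lemma isPolyRep (h : IsTwist ρ N P) : IsPolyRep P := by
  have hext : ∀ A B : Matrix (Fin (Module.finrank ℂ V)) (Fin (Module.finrank ℂ V)) ℂ,
      (∀ x : V, A *ᵥ (Module.finBasis ℂ V).equivFun x = B *ᵥ (Module.finBasis ℂ V).equivFun x) →
        A = B := fun A B hAB => by
    refine Matrix.toLin'.injective (LinearMap.ext fun y => ?_)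
    obtain ⟨x, rfl⟩ := (Module.finBasis ℂ V).equivFun.surjective y
    exact hAB x
  constructor
  · refine hext _ _ fun x => ?_
    have := h 1 x
    simpa using this
  · intro A B hA hB
    obtain ⟨a, rfl⟩ := exists_GL_eq hA
    obtain ⟨b, rfl⟩ := exists_GL_eq hB
    refine hext _ _ fun x => ?_
    rw [← mulVec_mulVec, h b, mulVec_smul, h a, ← Units.val_mul, h (a * b), map_mul, smul_smul,
      Units.val_mul, det_mul, mul_pow, mul_comm]
    rfl

lemma isIrreduciblePoly (h : IsTwist ρ N P) (hρ : ρ.IsIrreducible) : IsIrreduciblePoly P := by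
  intro W hW
  rcases eq_bot_or_eq_top_of_irreducible hρ
    (W.comap (Module.finBasis ℂ V).equivFun.toLinearMap) (fun g x hx => by
      have h1 := hW g (GL_det_ne_zero g) _ hx
      rw [LinearEquiv.coe_coe, h g x] at h1
      have h2 := W.smul_mem ((g : Matrix (Fin n) (Fin n) ℂ).det ^ N)⁻¹ h1
      rwa [smul_smul, inv_mul_cancel₀ (pow_ne_zero _ (GL_det_ne_zero g)), one_smul] at h2)
    with h1 | h1
  · left
    rw [eq_bot_iff]
    intro y hy
    obtain ⟨x, rfl⟩ := (Module.finBasis ℂ V).equivFun.surjective y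
    have h2 : x ∈ W.comap (Module.finBasis ℂ V).equivFun.toLinearMap := hy
    rw [h1, Submodule.mem_bot] at h2
    rw [h2, map_zero]
    exact Submodule.zero_mem _
  · right
    rw [eq_top_iff]
    intro y _
    obtain ⟨x, rfl⟩ := (Module.finBasis ℂ V).equivFun.surjective y
    have h2 : x ∈ W.comap (Module.finBasis ℂ V).equivFun.toLinearMap := by rw [h1]; trivial
    exact h2

lemma isHighestVec (h : IsTwist ρ N P) {l : Fin n → ℤ} {v : V} (hv0 : v ≠ 0)
    (hv : ∀ g : GL (Fin n) ℂ, (g : Matrix (Fin n) (Fin n) ℂ).BlockTriangular id →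
      ρ g v = weightChar l g • v) :
    IsHighestVec P (fun i => l i + N) ((Module.finBasis ℂ V).equivFun v) := by
  constructor
  · exact fun h0 => hv0 ((Module.finBasis ℂ V).equivFun.map_eq_zero_iff.mp h0)
  · intro A hA hAtri
    obtain ⟨g, rfl⟩ := exists_GL_eq hA
    have hdiag := hA
    rw [Matrix.det_of_isUpperTriangular hAtri, Finset.prod_ne_zero_iff] at hdiag
    rw [h g, hv g hAtri, map_smul, smul_smul, Matrix.det_of_isUpperTriangular hAtri, weightChar,
      ← Finset.prod_pow, ← Finset.prod_mul_distrib]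
    congr 1
    refine Finset.prod_congr rfl fun i hi => ?_
    rw [zpow_add₀ (hdiag i hi), mul_comm, zpow_natCast]

lemma mem_weightSpace_zero (h : IsTwist ρ N P) {x : V} : x ∈ weightSpace ρ 0 ↔
    IsWeightVec P (fun _ => (N : ℤ)) ((Module.finBasis ℂ V).equivFun x) := by
  constructor
  · intro hx t ht
    obtain ⟨g, hg⟩ := exists_GL_eq (det_diagonal_ne_zero ht)
    have h1 := hx g (by rw [hg]; exact Matrix.isDiag_diagonal t)
    rw [← hg, h g, h1, hg, det_diagonal, weightChar]
    simp [Finset.prod_pow]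
  · intro hx g hg
    have hgd : (g : Matrix (Fin n) (Fin n) ℂ) = diagonal (g : Matrix (Fin n) (Fin n) ℂ).diag :=
      hg.diagonal_diag.symm
    have hdet := GL_det_ne_zero g
    rw [hgd, det_diagonal, Finset.prod_ne_zero_iff] at hdet
    have h1 := hx _ fun i => hdet i (Finset.mem_univ i)
    have h0 : (g : Matrix (Fin n) (Fin n) ℂ).det = ∏ i, (g : Matrix (Fin n) (Fin n) ℂ).diag i := by
      conv_lhs => rw [hgd, det_diagonal]
    rw [← hgd, h g, h0, ← Finset.prod_pow] at h1
    simp only [zpow_natCast] at h1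
    have h2 : (∏ i, (g : Matrix (Fin n) (Fin n) ℂ).diag i ^ N) ≠ 0 :=
      Finset.prod_ne_zero_iff.mpr fun i hi => pow_ne_zero _ (hdet i hi)
    have h3 := (Module.finBasis ℂ V).equivFun.injective (smul_right_injective _ h2 h1)
    rw [h3, weightChar]
    simp

/-- The twist shifts every weight by `N`, so `weightMat` at the constant weight `N` projects onto
the zero weight space, and the trace of a projection is its rank. -/
lemma finrank_weightSpace_zero (h : IsTwist ρ N P) :
    (Module.finrank ℂ (weightSpace ρ 0) : ℂ) =
      (weightMat P (Finsupp.equivFunOnFinite.symm fun _ => N)).trace := by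
  have hproj : LinearMap.IsProj (weightSpace ρ 0)
      (Matrix.toLin (Module.finBasis ℂ V) (Module.finBasis ℂ V)
        (weightMat P (Finsupp.equivFunOnFinite.symm fun _ => N))) := by
    have hC : ∀ C x, (Module.finBasis ℂ V).equivFun
        (Matrix.toLin (Module.finBasis ℂ V) (Module.finBasis ℂ V) C x) =
        C *ᵥ (Module.finBasis ℂ V).equivFun x := fun C x => by
      have h1 := LinearMap.toMatrix_mulVec_repr (Module.finBasis ℂ V) (Module.finBasis ℂ V)
        (Matrix.toLin (Module.finBasis ℂ V) (Module.finBasis ℂ V) C) x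
      rw [LinearMap.toMatrix_toLin] at h1
      exact h1.symm
    constructor
    · intro x
      rw [h.mem_weightSpace_zero, hC]
      exact h.isPolyRep.isWeightVec_weightMat _ _
    · intro x hx
      refine (Module.finBasis ℂ V).equivFun.injective ?_
      rw [hC]
      exact h.isPolyRep.weightMat_mulVec_of_eq (h.mem_weightSpace_zero.mp hx)
  rw [← hproj.trace, LinearMap.trace_eq_matrix_trace ℂ (Module.finBasis ℂ V),
    LinearMap.toMatrix_toLin]

end IsTwist

end Linearize

/-! ### The zero weight space, the centre and the dual for `GL₄` -/

section Four

variable {V : Type*} [AddCommGroup V] [Module ℂ V] [FiniteDimensional ℂ V]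
  {ρ : Representation ℂ (GL (Fin 4) ℂ) V} {l : Fin 4 → ℤ}

/-- The character formula and the pattern expansion have the same product with the Vandermonde
product; cancelling it identifies the character with `patternPoly`, and the coefficient of
`(X₀X₁X₂X₃) ^ N` is read off. -/
lemma finrank_weightSpace_eq_patternCount (hρ : IsRational ρ) (hirr : ρ.IsIrreducible)
    (h01 : l 0 ≥ l 1) (h12 : l 1 ≥ l 2) (h23 : l 2 ≥ l 3) (hl : HasHighestWeight ρ l)
    (hsum : l 0 + l 1 + l 2 + l 3 = 0) :
    (Module.finrank ℂ (weightSpace ρ 0) : ℝ) = patternCount l := by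
  obtain ⟨N, P, hP⟩ := hρ.exists_isTwist
  obtain ⟨v, hv0, hv⟩ := hl
  have hv' := hP.isHighestVec hv0 hv
  obtain ⟨m, hm⟩ := hv'.exists_nat_weight hP.isPolyRep
  rw [← hm] at hv'
  have hml : ∀ i, (m i : ℤ) = l i + N := congrFun hm
  have hm0 := hml 0
  have hm1 := hml 1
  have hm2 := hml 2
  have hm3 := hml 3
  have hanti : Antitone m := by
    refine Fin.antitone_iff_succ_le.mpr fun i => ?_
    fin_cases i <;> simp <;> omega
  have hwcf := hv'.vandermondeFour_mul_torusTrace hP.isPolyRep (hP.isIrreduciblePoly hirr) hanti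
  have hLanti : StrictAnti (⇑m + ![3, 2, 1, 0]) := by
    have h3 : StrictAnti (![3, 2, 1, 0] : Fin 4 → ℕ) := by decide
    exact fun i j hij => add_lt_add_of_le_of_lt (hanti hij.le) (h3 hij)
  rw [← vandermondeFour_mul_patternPoly hLanti] at hwcf
  have hQ := mul_left_cancel₀ vandermondeFour_ne_zero hwcf
  have e0 : (⇑m + ![3, 2, 1, 0] : Fin 4 → ℕ) 0 = m 0 + 3 := rfl
  have e1 : (⇑m + ![3, 2, 1, 0] : Fin 4 → ℕ) 1 = m 1 + 2 := rfl
  have e2 : (⇑m + ![3, 2, 1, 0] : Fin 4 → ℕ) 2 = m 2 + 1 := rfl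
  have e3 : (⇑m + ![3, 2, 1, 0] : Fin 4 → ℕ) 3 = m 3 := rfl
  have hc : (Module.finrank ℂ (weightSpace ρ 0) : ℂ) = patternCount l := by
    rw [hP.finrank_weightSpace_zero, ← mul_one (weightMat P _), ← coeff_torusTrace, hQ,
      coeff_patternPoly_eq_patternCount (l := l) (N := N)]
    all_goals
      simp only [e0, e1, e2, e3]
      omega
  exact_mod_cast hc

lemma center_apply_highest {V : Type*} [AddCommGroup V] [Module ℂ V]
    {ρ : Representation ℂ (GL (Fin 4) ℂ) V} {l : Fin 4 → ℤ} {v : V} (hv : ∀ g : GL (Fin 4) ℂ,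
      (g : Matrix (Fin 4) (Fin 4) ℂ).BlockTriangular id → ρ g v = weightChar l g • v)
    {z : GL (Fin 4) ℂ} {c : ℂ} (hz : (z : Matrix (Fin 4) (Fin 4) ℂ) = diagonal fun _ => c) :
    ρ z v = c ^ (l 0 + l 1 + l 2 + l 3) • v := by
  have hc : c ≠ 0 := by
    have h1 := GL_det_ne_zero z
    rw [hz, det_diagonal, Finset.prod_ne_zero_iff] at h1
    exact h1 0 (Finset.mem_univ _)
  rw [hv z (by rw [hz]; exact Matrix.blockTriangular_diagonal _), weightChar, Fin.prod_univ_four,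
    hz]
  simp only [diagonal_apply_eq]
  rw [zpow_add₀ hc, zpow_add₀ hc, zpow_add₀ hc]

lemma hasTrivialCentralChar_iff {V : Type*} [AddCommGroup V] [Module ℂ V]
    {ρ : Representation ℂ (GL (Fin 4) ℂ) V} {l : Fin 4 → ℤ} (hirr : ρ.IsIrreducible)
    (hl : HasHighestWeight ρ l) : HasTrivialCentralChar ρ ↔ l 0 + l 1 + l 2 + l 3 = 0 := by
  obtain ⟨v, hv0, hv⟩ := hl
  constructor
  · intro h
    -- The scalar 2 detects the sum of the weights, because `2 ^ k = 1` only for `k = 0`.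
    obtain ⟨z, hz⟩ := exists_GL_eq (n := 4) (det_diagonal_ne_zero (t := fun _ => 2) (by simp))
    have h1 := h z (Matrix.GeneralLinearGroup.mem_center_iff_val_mem_range_scalar.mpr
      ⟨2, by rw [hz]; rfl⟩)
    have h2 := center_apply_highest hv hz
    rw [h1, Module.End.one_apply] at h2
    have h3 : ((2 : ℂ) ^ (l 0 + l 1 + l 2 + l 3) - 1) • v = 0 := by
      rw [sub_smul, one_smul, ← h2, sub_self]
    have h4 := (smul_eq_zero.mp h3).resolve_right hv0
    have h5 := congrArg (‖·‖) (sub_eq_zero.mp h4)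
    simp only [norm_zpow, Complex.norm_ofNat, norm_one] at h5
    refine zpow_right_injective₀ (a := (2 : ℝ)) (by norm_num) (by norm_num) ?_
    simpa using h5
  · intro hsum z hz
    obtain ⟨c, hc⟩ := Matrix.GeneralLinearGroup.mem_center_iff_val_mem_range_scalar.mp hz
    have h1 : ρ z v = v := by
      rw [center_apply_highest hv (c := c) hc.symm, hsum, zpow_zero, one_smul]
    -- The fixed space of a central element is invariant, and it contains `v`.
    rcases eq_bot_or_eq_top_of_irreducible hirr (LinearMap.eqLocus (ρ z) 1) (fun g x hx => by
      rw [LinearMap.mem_eqLocus] at hx ⊢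
      rw [← Module.End.mul_apply, ← map_mul, ← (Subgroup.mem_center_iff.mp hz g), map_mul,
        Module.End.mul_apply, hx]
      rfl) with h2 | h2
    · exfalso
      have h3 : v ∈ LinearMap.eqLocus (ρ z) 1 := h1
      rw [h2, Submodule.mem_bot] at h3
      exact hv0 h3
    · refine LinearMap.ext fun x => ?_
      have h3 : x ∈ LinearMap.eqLocus (ρ z) 1 := by rw [h2]; trivial
      exact h3

lemma HasTrivialCentralChar.dual {n : ℕ} {V : Type*} [AddCommGroup V] [Module ℂ V]
    {ρ : Representation ℂ (GL (Fin n) ℂ) V} (h : HasTrivialCentralChar ρ) :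
    HasTrivialCentralChar ρ.dual := by
  intro z hz
  rw [Representation.dual_apply, h z⁻¹ (Subgroup.inv_mem _ hz)]
  rfl

lemma IsRational.dual {n : ℕ} {V : Type*} [AddCommGroup V] [Module ℂ V] [FiniteDimensional ℂ V]
    {ρ : Representation ℂ (GL (Fin n) ℂ) V} (hρ : IsRational ρ) : IsRational ρ.dual := by
  intro f Φ
  obtain ⟨x, rfl⟩ := (Module.evalEquiv ℂ V).surjective Φ
  exact (hρ x f).comp_inv

/-- In finite dimension an invariant subspace of the dual is the annihilator of its coannihilator,
which is invariant in `V`. -/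
lemma isIrreducible_dual {G V : Type*} [Group G] [AddCommGroup V] [Module ℂ V]
    [FiniteDimensional ℂ V] {ρ : Representation ℂ G V} (hρ : ρ.IsIrreducible) :
    ρ.dual.IsIrreducible := by
  have hnt : Nontrivial V := by
    by_contra hV
    rw [not_nontrivial_iff_subsingleton] at hV
    exact hρ.exists_pair_ne.elim fun a ⟨b, hab⟩ => hab (SetLike.ext fun x => by
      rw [Subsingleton.elim x 0]
      exact ⟨fun _ => b.toSubmodule.zero_mem, fun _ => a.toSubmodule.zero_mem⟩)
  have hntd : Nontrivial (Module.Dual ℂ V) := inferInstance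
  refine { exists_pair_ne := ⟨⊥, ⊤, fun h => ?_⟩, eq_bot_or_eq_top := fun W => ?_ }
  · exact bot_ne_top (α := Submodule ℂ (Module.Dual ℂ V))
      (congrArg Subrepresentation.toSubmodule h)
  · have hW : W.toSubmodule.dualCoannihilator.dualAnnihilator = W.toSubmodule :=
      Subspace.dualCoannihilator_dualAnnihilator_eq
    rcases eq_bot_or_eq_top_of_irreducible hρ W.toSubmodule.dualCoannihilator
      (fun g x hx => by
        rw [Submodule.mem_dualCoannihilator] at hx ⊢
        intro φ hφ
        have h1 := hx _ (W.apply_mem_toSubmodule g⁻¹ hφ)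
        rw [Representation.dual_apply, inv_inv] at h1
        exact h1) with h1 | h1
    · right
      rw [h1, Submodule.dualAnnihilator_bot] at hW
      exact Subrepresentation.toSubmodule_injective hW.symm
    · left
      rw [h1, Submodule.dualAnnihilator_top] at hW
      exact Subrepresentation.toSubmodule_injective hW.symm

lemma hasHighestWeight_dual (hρ : IsRational ρ) (hirr : ρ.IsIrreducible)
    (hl : HasHighestWeight ρ l) : HasHighestWeight ρ.dual (dualWeight l) := by
  obtain ⟨N, P, hP⟩ := hρ.exists_isTwist
  obtain ⟨v, hv0, hv⟩ := hl
  have hv' := hP.isHighestVec hv0 hv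
  obtain ⟨m, hm⟩ := hv'.exists_nat_weight hP.isPolyRep
  rw [← hm] at hv'
  set E := (Module.finBasis ℂ V).equivFun with hE
  obtain ⟨a, ha⟩ := Function.ne_iff.mp hv'.ne_zero
  obtain ⟨w, hw⟩ := exists_GL_eq (n := 4) (A := Fin.revPerm.permMatrix ℂ) (by
    rw [Matrix.det_permutation]
    exact_mod_cast (Equiv.Perm.sign (Fin.revPerm (n := 4))).ne_zero)
  -- The highest weight projection precomposed with the longest permutation `w`, followed by a
  -- coordinate `a` in which `v` does not vanish; hence `φ (ρ w⁻¹ v) ≠ 0`.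
  set φ : Module.Dual ℂ V := (LinearMap.proj a : (Fin (Module.finrank ℂ V) → ℂ) →ₗ[ℂ] ℂ) ∘ₗ
    Matrix.toLin' (weightMat P m) ∘ₗ E.toLinearMap ∘ₗ ρ w with hφ
  have hφa : ∀ x, φ x = (weightMat P m *ᵥ E (ρ w x)) a := fun x => rfl
  refine ⟨φ, fun h0 => ha ?_, fun b hb => LinearMap.ext fun x => ?_⟩
  · have h1 := hφa (ρ w⁻¹ v)
    rw [h0, ← Module.End.mul_apply, ← map_mul, mul_inv_cancel, map_one, Module.End.one_apply,
      hP.isPolyRep.weightMat_mulVec_of_eq hv'.isWeightVec] at h1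
    exact h1.symm
  · change φ (ρ b⁻¹ x) = weightChar (dualWeight l) b • φ x
    -- Conjugation by `w` makes `b⁻¹` lower triangular with reversed, inverted diagonal, and the
    -- highest weight projection is an eigenvector for such matrices; this gives the weight
    -- `dualWeight l`.
    obtain ⟨g, hg⟩ : ∃ g, g = w * b⁻¹ * w⁻¹ := ⟨_, rfl⟩
    have hgw : g * w = w * b⁻¹ := by rw [hg, inv_mul_cancel_right]
    have hbinv : ((b⁻¹ : GL (Fin 4) ℂ) : Matrix (Fin 4) (Fin 4) ℂ).BlockTriangular id := by
      rw [Matrix.coe_units_inv]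
      have : Invertible (b : Matrix (Fin 4) (Fin 4) ℂ) := b.invertible
      exact Matrix.blockTriangular_inv_of_blockTriangular hb
    have hgsub : (g : Matrix (Fin 4) (Fin 4) ℂ) =
        ((b⁻¹ : GL (Fin 4) ℂ) : Matrix (Fin 4) (Fin 4) ℂ).submatrix Fin.rev Fin.rev := by
      have h1 : (g : Matrix (Fin 4) (Fin 4) ℂ) * (w : Matrix (Fin 4) (Fin 4) ℂ) =
          (w : Matrix (Fin 4) (Fin 4) ℂ) * ((b⁻¹ : GL (Fin 4) ℂ) : Matrix (Fin 4) (Fin 4) ℂ) :=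
        congrArg Units.val hgw
      rw [hw, Equiv.Perm.permMatrix, PEquiv.toMatrix_toPEquiv_mul,
        PEquiv.mul_toMatrix_toPEquiv] at h1
      ext i j
      have h2 := congrFun (congrFun h1 i) (Fin.rev j)
      simpa using h2
    have hglow : ∀ i j, i < j → (g : Matrix (Fin 4) (Fin 4) ℂ) i j = 0 := fun i j hij => by
      rw [hgsub]
      exact hbinv (Fin.rev_lt_rev.mpr hij)
    have hdiag : ∀ i, (g : Matrix (Fin 4) (Fin 4) ℂ) i i =
        ((b : Matrix (Fin 4) (Fin 4) ℂ) (Fin.rev i) (Fin.rev i))⁻¹ := fun i => by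
      have h1 : ∀ k, ((b⁻¹ : GL (Fin 4) ℂ) : Matrix (Fin 4) (Fin 4) ℂ) k k *
          (b : Matrix (Fin 4) (Fin 4) ℂ) k k = 1 := fun k => by
        have h2 : ((b⁻¹ : GL (Fin 4) ℂ) : Matrix (Fin 4) (Fin 4) ℂ) *
            (b : Matrix (Fin 4) (Fin 4) ℂ) = 1 := by
          rw [← Units.val_mul, inv_mul_cancel, Units.val_one]
        have h3 := congrFun (congrFun h2 k) k
        rw [Matrix.mul_apply, Matrix.one_apply_eq, Finset.sum_eq_single k] at h3
        · exact h3
        · intro j _ hj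
          rcases lt_or_gt_of_ne hj with hjk | hjk
          · rw [hbinv hjk, zero_mul]
          · rw [hb hjk, mul_zero]
        · simp
      rw [hgsub]
      exact eq_inv_of_mul_eq_one_left (h1 _)
    have hdet : (g : Matrix (Fin 4) (Fin 4) ℂ).det = ∏ i, (g : Matrix (Fin 4) (Fin 4) ℂ) i i :=
      Matrix.det_of_isLowerTriangular _ fun i j hij => hglow i j hij
    have hne : ∀ i, (g : Matrix (Fin 4) (Fin 4) ℂ) i i ≠ 0 := fun i => by
      have h1 := GL_det_ne_zero g
      rw [hdet, Finset.prod_ne_zero_iff] at h1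
      exact h1 i (Finset.mem_univ i)
    have hlow := hv'.weightMat_mul_polyMap hP.isPolyRep (hP.isIrreduciblePoly hirr) hglow
      (GL_det_ne_zero g)
    have h1 : weightMat P m *ᵥ E (ρ g (ρ w x)) =
        (∏ i, (g : Matrix (Fin 4) (Fin 4) ℂ) i i ^ l i) • weightMat P m *ᵥ E (ρ w x) := by
      have h2 := congrArg (weightMat P m *ᵥ ·) (hP g (ρ w x))
      simp only [mulVec_mulVec, hlow, smul_mulVec, mulVec_smul, ← hE] at h2
      have h3 : ∏ i, (g : Matrix (Fin 4) (Fin 4) ℂ) i i ^ m i =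
          (g : Matrix (Fin 4) (Fin 4) ℂ).det ^ N *
            ∏ i, (g : Matrix (Fin 4) (Fin 4) ℂ) i i ^ l i := by
        rw [hdet, ← Finset.prod_pow, ← Finset.prod_mul_distrib]
        refine Finset.prod_congr rfl fun i _ => ?_
        have h4 : (m i : ℤ) = l i + N := congrFun hm i
        rw [← zpow_natCast, h4, zpow_add₀ (hne i), zpow_natCast, mul_comm]
      rw [h3, ← smul_smul] at h2
      exact (smul_right_injective _ (pow_ne_zero N (GL_det_ne_zero g)) h2).symm
    rw [hφa, hφa, ← Module.End.mul_apply, ← map_mul, ← hgw, map_mul, Module.End.mul_apply, h1,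
      Pi.smul_apply]
    congr 1
    simp only [weightChar, Fin.prod_univ_four, hdiag, dualWeight]
    simp only [_root_.inv_zpow', Matrix.cons_val, Matrix.cons_val_zero, Matrix.cons_val_one]
    have r0 : Fin.rev (0 : Fin 4) = 3 := rfl
    have r1 : Fin.rev (1 : Fin 4) = 2 := rfl
    have r2 : Fin.rev (2 : Fin 4) = 1 := rfl
    have r3 : Fin.rev (3 : Fin 4) = 0 := rfl
    rw [r0, r1, r2, r3]
    ring

end Four

/-! ### The regions and the polynomials under duality -/

section Regions

lemma dualWeight_dualWeight (x : Fin 4 → ℝ) : dualWeight (dualWeight x) = x := by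
  ext i
  fin_cases i <;> simp [dualWeight]

lemma dualWeight_image {S T : Set (Fin 4 → ℝ)} (h : ∀ x, dualWeight x ∈ S ↔ x ∈ T) :
    dualWeight '' S = T := by
  ext x
  constructor
  · rintro ⟨y, hy, rfl⟩
    rw [← h, dualWeight_dualWeight]
    exact hy
  · exact fun hx => ⟨dualWeight x, (h x).mpr hx, dualWeight_dualWeight x⟩

lemma dualWeight_mem_domain {x : Fin 4 → ℝ} : dualWeight x ∈ domain ↔ x ∈ domain := by
  simp only [domain, dualWeight, Set.mem_ofPred_eq, Matrix.cons_val, Matrix.cons_val_zero,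
    Matrix.cons_val_one]
  constructor
  · rintro ⟨h1, h2, h3, h4⟩
    exact ⟨by linarith, by linarith, by linarith, by linarith⟩
  · rintro ⟨h1, h2, h3, h4⟩
    exact ⟨by linarith, by linarith, by linarith, by linarith⟩

lemma dualWeight_image_region₁ : dualWeight '' region₁ = region₂ := by
  refine dualWeight_image fun x => and_congr dualWeight_mem_domain ?_
  simp [dualWeight]

lemma dualWeight_image_region₂ : dualWeight '' region₂ = region₁ := by
  refine dualWeight_image fun x => and_congr dualWeight_mem_domain ?_
  simp [dualWeight]

lemma dualWeight_image_region₃ : dualWeight '' region₃ = region₄ := by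
  refine dualWeight_image fun x => and_congr dualWeight_mem_domain ?_
  simp only [dualWeight, Matrix.cons_val, Matrix.cons_val_zero, Matrix.cons_val_one]
  constructor
  · rintro ⟨h1, h2, h3⟩
    exact ⟨by linarith, by linarith, by linarith⟩
  · rintro ⟨h1, h2, h3⟩
    exact ⟨by linarith, by linarith, by linarith⟩

lemma dualWeight_image_region₄ : dualWeight '' region₄ = region₃ := by
  refine dualWeight_image fun x => and_congr dualWeight_mem_domain ?_
  simp only [dualWeight, Matrix.cons_val, Matrix.cons_val_zero, Matrix.cons_val_one]
  constructor
  · rintro ⟨h1, h2, h3⟩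
    exact ⟨by linarith, by linarith, by linarith⟩
  · rintro ⟨h1, h2, h3⟩
    exact ⟨by linarith, by linarith, by linarith⟩

lemma union_regions : region₁ ∪ region₂ ∪ region₃ ∪ region₄ = domain := by
  ext x
  constructor
  · rintro (((h | h) | h) | h) <;> exact h.1
  · intro h
    rcases le_or_gt (x 1) 0 with h1 | h1
    · exact Or.inl (Or.inl (Or.inl ⟨h, h1⟩))
    · rcases le_or_gt 0 (x 2) with h2 | h2
      · exact Or.inl (Or.inl (Or.inr ⟨h, h2⟩))
      · rcases le_total 0 (x 0 + x 3) with h3 | h3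
        · exact Or.inl (Or.inr ⟨h, h1, h2, h3⟩)
        · exact Or.inr ⟨h, h1, h2, h3⟩

lemma polynomials_dualWeight (x : Fin 4 → ℝ) (hx : x 0 + x 1 + x 2 + x 3 = 0) :
    p₁ (dualWeight x) = p₂ x ∧ p₂ (dualWeight x) = p₁ x ∧ p₃ (dualWeight x) = p₄ x ∧
      p₄ (dualWeight x) = p₃ x := by
  have h3 : x 3 = -x 0 - x 1 - x 2 := by linarith
  simp only [p₁, p₂, p₃, p₄, dualWeight, Matrix.cons_val, Matrix.cons_val_zero,
    Matrix.cons_val_one, h3]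
  refine ⟨?_, ?_, ?_, ?_⟩ <;> ring

end Regions

end ZeroWeight
end

theorem mainTheorem4 :
    -- the dimension formula, for every irreducible rational representation
    (∀ (V : Type*) [AddCommGroup V] [Module ℂ V] [FiniteDimensional ℂ V]
      (ρ : Representation ℂ (Matrix.GeneralLinearGroup (Fin 4) ℂ) V) (l : Fin 4 → ℤ),
      ZeroWeight.IsRational ρ → ρ.IsIrreducible → l 0 ≥ l 1 → l 1 ≥ l 2 → l 2 ≥ l 3 →
      ZeroWeight.HasHighestWeight ρ l →
      (ZeroWeight.HasTrivialCentralChar ρ ↔ l 0 + l 1 + l 2 + l 3 = 0) ∧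
      (ZeroWeight.HasTrivialCentralChar ρ →
        ((fun i => (l i : ℝ)) ∈ ZeroWeight.region₁ →
          (Module.finrank ℂ (ZeroWeight.weightSpace ρ 0) : ℝ) =
            ZeroWeight.p₁ fun i => (l i : ℝ)) ∧
        ((fun i => (l i : ℝ)) ∈ ZeroWeight.region₂ →
          (Module.finrank ℂ (ZeroWeight.weightSpace ρ 0) : ℝ) =
            ZeroWeight.p₂ fun i => (l i : ℝ)) ∧
        ((fun i => (l i : ℝ)) ∈ ZeroWeight.region₃ →
          (Module.finrank ℂ (ZeroWeight.weightSpace ρ 0) : ℝ) =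
            ZeroWeight.p₃ fun i => (l i : ℝ)) ∧
        ((fun i => (l i : ℝ)) ∈ ZeroWeight.region₄ →
          (Module.finrank ℂ (ZeroWeight.weightSpace ρ 0) : ℝ) =
            ZeroWeight.p₄ fun i => (l i : ℝ)) ∧
        -- the dual representation has the dual highest weight
        ZeroWeight.IsRational ρ.dual ∧ ρ.dual.IsIrreducible ∧
        ZeroWeight.HasTrivialCentralChar ρ.dual ∧
        ZeroWeight.HasHighestWeight ρ.dual (ZeroWeight.dualWeight l))) ∧
    -- the four regions make up the whole domain
    ZeroWeight.region₁ ∪ ZeroWeight.region₂ ∪ ZeroWeight.region₃ ∪ ZeroWeight.region₄ =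
      ZeroWeight.domain ∧
    -- duality interchanges the regions
    ZeroWeight.dualWeight '' ZeroWeight.region₁ = ZeroWeight.region₂ ∧
    ZeroWeight.dualWeight '' ZeroWeight.region₂ = ZeroWeight.region₁ ∧
    ZeroWeight.dualWeight '' ZeroWeight.region₃ = ZeroWeight.region₄ ∧
    ZeroWeight.dualWeight '' ZeroWeight.region₄ = ZeroWeight.region₃ ∧
    -- duality interchanges the polynomials
    (∀ x : Fin 4 → ℝ, x 0 + x 1 + x 2 + x 3 = 0 →
      ZeroWeight.p₁ (ZeroWeight.dualWeight x) = ZeroWeight.p₂ x ∧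
      ZeroWeight.p₂ (ZeroWeight.dualWeight x) = ZeroWeight.p₁ x ∧
      ZeroWeight.p₃ (ZeroWeight.dualWeight x) = ZeroWeight.p₄ x ∧
      ZeroWeight.p₄ (ZeroWeight.dualWeight x) = ZeroWeight.p₃ x) ∧
    (∀ x : Fin 4 → ℝ,
      ZeroWeight.p₃ x - ZeroWeight.p₄ x = (x 1 + x 2) - (x 1 + x 2) ^ 3) := by
  refine ⟨fun V _ _ _ ρ l hρ hirr h01 h12 h23 hl => ?_, ZeroWeight.union_regions,
    ZeroWeight.dualWeight_image_region₁, ZeroWeight.dualWeight_image_region₂,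
    ZeroWeight.dualWeight_image_region₃, ZeroWeight.dualWeight_image_region₄,
    ZeroWeight.polynomials_dualWeight, fun x => ?_⟩
  · have hiff := ZeroWeight.hasTrivialCentralChar_iff hirr hl
    refine ⟨hiff, fun htriv => ?_⟩
    have hsum := hiff.mp htriv
    rw [ZeroWeight.finrank_weightSpace_eq_patternCount hρ hirr h01 h12 h23 hl hsum]
    refine ⟨fun h => ?_, fun h => ?_, fun h => ?_, fun h => ?_, hρ.dual,
      ZeroWeight.isIrreducible_dual hirr, htriv.dual,
      ZeroWeight.hasHighestWeight_dual hρ hirr hl⟩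
    · exact ZeroWeight.patternCount_region₁ h12 h23 hsum (Int.cast_nonpos.mp h.2)
    · exact ZeroWeight.patternCount_region₂ h01 h12 hsum (Int.cast_nonneg_iff.mp h.2)
    · exact ZeroWeight.patternCount_region₃ h23 hsum (Int.cast_pos.mp h.2.1)
        (Int.cast_lt_zero.mp h.2.2.1) (by simpa [← Int.cast_add] using h.2.2.2)
    · exact ZeroWeight.patternCount_region₄ h01 hsum (Int.cast_pos.mp h.2.1)
        (Int.cast_lt_zero.mp h.2.2.1) (by simpa [← Int.cast_add] using h.2.2.2)
  · simp only [ZeroWeight.p₃, ZeroWeight.p₄]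
    ring
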